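/- Let $A$ and $B$ be C*-algebras (not necessarily unital), let $\mathcal M(B)$ be the multiplier algebra of $B$, and let $\varphi\colon A\to\mathcal M(B)$ be a $*$-homomorphism. Let $\mathbb I(A)$ and $\mathbb I(B)$ be the lattices of closed two-sided ideals, ordered by inclusion. For $J\in\mathbb I(B)$ and $I\in\mathbb I(A)$ put $$r(J)=\{a\in A : \varphi(a)B+B\varphi(a)\subseteq J\}\in\mathbb I(A),\qquad i(I)=\overline{\operatorname{span}}\{b_1\varphi(x)b_2 : b_1,b_2\in B,\ x\in I\}\in\mathbb I(B).$$ Let $\mathbb I^B(A)=r(\mathbb I(B))$ be the lattice of restricted ideals of $A$ and $\mathbb I^A(B)=i(\mathbb I(A))$ the lattice of induced ideals of $B$. An element $p$ of a lattice is prime if it is not the greatest element and $a\wedge b\le p$ implies $a\le p$ or $b\le p$. Let $\mathrm{Prime}^B(A)$ and $\mathrm{Prime}^A(B)$ be the sets of prime elements of the lattices $\mathbb I^B(A)$ and $\mathbb I^A(B)$, respectively, each with the topology whose open sets are $U_a=\{p : a\not\le p\}$ for $a$ in the lattice. Let $\check A$ be the space of primitive ideals of $A$ (kernels of nonzero irreducible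 representations) with the hull-kernel topology. Assume (JR) the join in $\mathbb I(A)$ of any family of restricted ideals is restricted (including the empty family, whose join is $0$). Then for each $\mathfrak p\in\check A$ there is a largest restricted ideal $\pi(\mathfrak p)$ contained in $\mathfrak p$, and this defines a continuous map $\pi\colon\check A\to\mathrm{Prime}^B(A)$. Let $\check A/{\sim}$, the quasi-orbit space, be the quotient space of $\check A$ by the relation $\mathfrak p\sim\mathfrak q\iff\pi(\mathfrak p)=\pi(\mathfrak q)$. If $\pi$ is open and surjective, then (C1) $I\cap r(i(J))=r(i(I\cap J))$ for all $I\in\mathbb I^B(A)$ and $J\in\mathbb I(A)$. Conversely, if (C1) holds and $\mathrm{Prime}^B(A)$ is first countable or $\check A$ is second countable, then $\pi$ is surjective and open, and it induces a homeomorphism $\check A/{\sim}\cong\mathrm{Prime}^A(B)$, namely $[\mathfrak p]\mapsto i(\pi(\mathfrak p))$. -/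

import Mathlib

namespace QuasiOrbit

universe u v

/-- A closed two-sided ideal of a C*-algebra (not necessarily unital). -/
structure ClosedIdeal (A : Type u) [NonUnitalCStarAlgebra A] extends Submodule ℂ A where
  isClosed' : IsClosed carrier
  mul_mem_left' : ∀ (a : A) {x : A}, x ∈ carrier → a * x ∈ carrier
  mul_mem_right' : ∀ (a : A) {x : A}, x ∈ carrier → x * a ∈ carrier

namespace ClosedIdeal

variable {A : Type u} [NonUnitalCStarAlgebra A]

instance : SetLike (ClosedIdeal A) A where
  coe I := I.carrier
  coe_injective I J h := by
    rcases I with ⟨I, _, _, _⟩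
    rcases J with ⟨J, _, _, _⟩
    have : I = J := SetLike.coe_injective h
    subst this
    rfl

/-- Closed ideals are ordered by inclusion. -/
instance : PartialOrder (ClosedIdeal A) := .ofSetLike (ClosedIdeal A) A

theorem le_iff {I J : ClosedIdeal A} : I ≤ J ↔ ∀ x ∈ I, x ∈ J := Iff.rfl

theorem isClosed (I : ClosedIdeal A) : IsClosed (I : Set A) := I.isClosed'

theorem mul_mem_left (I : ClosedIdeal A) (a : A) {x : A} (hx : x ∈ I) : a * x ∈ I :=
  I.mul_mem_left' a hx

theorem mul_mem_right (I : ClosedIdeal A) (a : A) {x : A} (hx : x ∈ I) : x * a ∈ I :=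
  I.mul_mem_right' a hx

/-- The meet of a family of ideals is its intersection. -/
instance : InfSet (ClosedIdeal A) where
  sInf S :=
    { carrier := ⋂ I ∈ S, (I : Set A)
      zero_mem' := Set.mem_iInter₂.2 fun I _ => I.toSubmodule.zero_mem
      add_mem' := fun hx hy => Set.mem_iInter₂.2 fun I hI =>
        I.toSubmodule.add_mem (Set.mem_iInter₂.1 hx I hI) (Set.mem_iInter₂.1 hy I hI)
      smul_mem' := fun c _ hx => Set.mem_iInter₂.2 fun I hI =>
        I.toSubmodule.smul_mem c (Set.mem_iInter₂.1 hx I hI)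
      isClosed' := isClosed_biInter fun I _ => I.isClosed
      mul_mem_left' := fun a _ hx => Set.mem_iInter₂.2 fun I hI =>
        I.mul_mem_left a (Set.mem_iInter₂.1 hx I hI)
      mul_mem_right' := fun a _ hx => Set.mem_iInter₂.2 fun I hI =>
        I.mul_mem_right a (Set.mem_iInter₂.1 hx I hI) }

theorem mem_sInf {S : Set (ClosedIdeal A)} {x : A} : x ∈ sInf S ↔ ∀ I ∈ S, x ∈ I :=
  Set.mem_iInter₂

/-- The complete lattice of closed two-sided ideals; `sSup S` is the smallest closed ideal that
contains every member of `S`, and `I ⊓ J` is the intersection. -/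
instance : CompleteLattice (ClosedIdeal A) where
  __ := completeLatticeOfInf (ClosedIdeal A) fun _ =>
    ⟨fun I hI _ hx => mem_sInf.1 hx I hI,
      fun _ hK _ hx => mem_sInf.2 fun _ hI => hK hI hx⟩
  inf I J :=
    { carrier := (I : Set A) ∩ J
      zero_mem' := ⟨I.toSubmodule.zero_mem, J.toSubmodule.zero_mem⟩
      add_mem' := fun hx hy =>
        ⟨I.toSubmodule.add_mem hx.1 hy.1, J.toSubmodule.add_mem hx.2 hy.2⟩
      smul_mem' := fun c _ hx =>
        ⟨I.toSubmodule.smul_mem c hx.1, J.toSubmodule.smul_mem c hx.2⟩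
      isClosed' := I.isClosed.inter J.isClosed
      mul_mem_left' := fun a _ hx => ⟨I.mul_mem_left a hx.1, J.mul_mem_left a hx.2⟩
      mul_mem_right' := fun a _ hx => ⟨I.mul_mem_right a hx.1, J.mul_mem_right a hx.2⟩ }
  inf_le_left _ _ _ hx := hx.1
  inf_le_right _ _ _ hx := hx.2
  le_inf _ _ _ h₁ h₂ _ hx := ⟨h₁ hx, h₂ hx⟩

theorem mem_inf {I J : ClosedIdeal A} {x : A} : x ∈ I ⊓ J ↔ x ∈ I ∧ x ∈ J := Iff.rfl

theorem mem_top (x : A) : x ∈ (⊤ : ClosedIdeal A) := by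
  have h : (⊤ : ClosedIdeal A) = sInf ∅ := sInf_empty.symm
  rw [h]
  exact mem_sInf.2 fun I hI => hI.elim

end ClosedIdeal

section Primitive

variable {A : Type u} [NonUnitalCStarAlgebra A]

/-- A nonzero representation `ρ` of `A` on a Hilbert space is irreducible if `0` and the whole
space are its only closed invariant subspaces. -/
def IsIrreducibleRep {H : Type u} [NormedAddCommGroup H] [InnerProductSpace ℂ H]
    [CompleteSpace H] (ρ : A →⋆ₙₐ[ℂ] (H →L[ℂ] H)) : Prop :=
  (∃ a, ρ a ≠ 0) ∧
    ∀ K : Submodule ℂ H, IsClosed (K : Set H) → (∀ a, ∀ x ∈ K, ρ a x ∈ K) → K = ⊥ ∨ K = ⊤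

/-- A primitive ideal is the kernel of an irreducible representation on a Hilbert space. (An
irreducible representation is cyclic, so Hilbert spaces in the universe of `A` suffice.) -/
def IsPrimitive (P : ClosedIdeal A) : Prop :=
  ∃ (H : Type u) (_ : NormedAddCommGroup H) (_ : InnerProductSpace ℂ H) (_ : CompleteSpace H)
    (ρ : A →⋆ₙₐ[ℂ] (H →L[ℂ] H)), IsIrreducibleRep ρ ∧ ∀ a, a ∈ P ↔ ρ a = 0

theorem IsPrimitive.ne_top {P : ClosedIdeal A} (hP : IsPrimitive P) : P ≠ ⊤ := by
  rintro rfl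
  obtain ⟨H, _, _, _, ρ, ⟨⟨a, ha⟩, -⟩, hk⟩ := hP
  exact ha ((hk a).1 (ClosedIdeal.mem_top a))

theorem IsPrimitive.le_or_le {P : ClosedIdeal A} (hP : IsPrimitive P) {I J : ClosedIdeal A}
    (h : I ⊓ J ≤ P) : I ≤ P ∨ J ≤ P := by
  obtain ⟨H, _, _, _, ρ, ⟨-, hirr⟩, hk⟩ := hP
  -- the closed invariant subspace of vectors annihilated by `I`
  let K : Submodule ℂ H :=
    { carrier := {x | ∀ a ∈ I, ρ a x = 0}
      zero_mem' := fun a _ => map_zero _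
      add_mem' := fun hx hy a ha => by rw [map_add, hx a ha, hy a ha, add_zero]
      smul_mem' := fun c x hx a ha => by rw [map_smul, hx a ha, smul_zero] }
  have hKc : IsClosed (K : Set H) := by
    have : (K : Set H) = ⋂ a ∈ I, {x | ρ a x = 0} := by
      ext x
      simp [K]
    rw [this]
    exact isClosed_biInter fun a _ => isClosed_eq (ρ a).continuous continuous_const
  have hKi : ∀ a, ∀ x ∈ K, ρ a x ∈ K := by
    intro a x hx b hb
    have : ρ (b * a) x = 0 := hx _ (I.mul_mem_right a hb)
    rwa [map_mul] at this
  rcases hirr K hKc hKi with hK | hK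
  · right
    intro b hb
    refine (hk b).2 (ContinuousLinearMap.ext fun x => ?_)
    have : ρ b x ∈ K := fun a ha => by
      have h0 : ρ (a * b) = 0 :=
        (hk _).1 (h ⟨I.mul_mem_right b ha, J.mul_mem_left a hb⟩)
      rw [map_mul] at h0
      exact congrArg (fun T : H →L[ℂ] H => T x) h0
    rw [hK] at this
    exact this
  · left
    intro a ha
    refine (hk a).2 (ContinuousLinearMap.ext fun x => ?_)
    have : x ∈ K := hK ▸ Submodule.mem_top
    exact this a ha

end Primitive

section Prime

/-- A (meet) prime element of a lattice `L`: it is not the greatest element, and if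
`a ∧ b ≤ p`, then `a ≤ p` or `b ≤ p`. (Excluding the greatest element makes prime elements
correspond to the lattice morphisms `L → {0, 1}`.) The meet is written through `IsGLB` so that it
is taken in `L` itself, even when `L` is a subset of a larger lattice in which meets differ. -/
def IsPrimeElement {L : Type*} [PartialOrder L] (p : L) : Prop :=
  ¬ IsMax p ∧ ∀ a b m : L, IsGLB {a, b} m → m ≤ p → a ≤ p ∨ b ≤ p

/-- The space of prime elements of a lattice. -/
def PrimeSpace (L : Type*) [PartialOrder L] : Type _ := {p : L // IsPrimeElement p}

/-- The topology on the space of prime elements, with open sets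
`U_a = {p | ¬ a ≤ p}` for `a : L`. -/
instance (L : Type*) [PartialOrder L] : TopologicalSpace (PrimeSpace L) :=
  TopologicalSpace.generateFrom (Set.range fun a : L => {p : PrimeSpace L | ¬ a ≤ p.1})

end Prime

/-- The primitive ideal space of `A`. -/
def PrimitiveSpace (A : Type u) [NonUnitalCStarAlgebra A] : Type u :=
  {P : ClosedIdeal A // IsPrimitive P}

/-- The hull-kernel topology on the primitive ideal space, with open sets
`{P | ¬ I ⊆ P}` for closed ideals `I`. -/
instance (A : Type u) [NonUnitalCStarAlgebra A] : TopologicalSpace (PrimitiveSpace A) :=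
  TopologicalSpace.generateFrom
    (Set.range fun I : ClosedIdeal A => {P : PrimitiveSpace A | ¬ I ≤ P.1})

section Galois

variable {A : Type u} [NonUnitalCStarAlgebra A] {B : Type v} [NonUnitalCStarAlgebra B]

/-- A multiplier of `B` commutes with right multiplications. -/
theorem fst_mul (m : DoubleCentralizer ℂ B) (x y : B) : m.fst (x * y) = m.fst x * y := by
  have h : ∀ z : B, z * (m.fst (x * y) - m.fst x * y) = 0 := fun z => by
    rw [mul_sub, ← m.central, ← mul_assoc, ← mul_assoc, ← m.central, sub_self]
  exact sub_eq_zero.1 (CStarRing.star_mul_self_eq_zero_iff _ |>.1 (h _))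

theorem snd_mul (m : DoubleCentralizer ℂ B) (x y : B) : m.snd (x * y) = x * m.snd y := by
  have h : ∀ z : B, (m.snd (x * y) - x * m.snd y) * z = 0 := fun z => by
    rw [sub_mul, m.central, mul_assoc, mul_assoc, m.central, sub_self]
  exact sub_eq_zero.1 (CStarRing.mul_star_self_eq_zero_iff _ |>.1 (h _))

/-- Multipliers of `B` map closed ideals of `B` to themselves. -/
theorem multiplier_mem (m : DoubleCentralizer ℂ B) (J : ClosedIdeal B) {x : B} (hx : x ∈ J) :
    m.fst x ∈ J ∧ m.snd x ∈ J := by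
  let _ := CStarAlgebra.spectralOrder B
  have := CStarAlgebra.spectralOrderedRing B
  have hl := (CStarAlgebra.increasingApproximateUnit B).toIsApproximateUnit
  constructor
  · have ht := (m.fst.continuous.tendsto x).comp (hl.tendsto_mul_right x)
    refine J.isClosed.mem_of_tendsto ht (Filter.Eventually.of_forall fun e => ?_)
    change m.fst (e * x) ∈ J
    rw [fst_mul]
    exact J.mul_mem_left _ hx
  · have ht := (m.snd.continuous.tendsto x).comp (hl.tendsto_mul_left x)
    refine J.isClosed.mem_of_tendsto ht (Filter.Eventually.of_forall fun e => ?_)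
    change m.snd (x * e) ∈ J
    rw [snd_mul]
    exact J.mul_mem_right _ hx

/-- The restriction `r(J) = {a | φ(a) B + B φ(a) ⊆ J}` of an ideal `J` of `B` along
`φ : A → M(B)`. For a multiplier `m` of `B`, `m.fst b` is `m · b` and `m.snd b` is `b · m`. -/
def restrict (φ : A →⋆ₙₐ[ℂ] DoubleCentralizer ℂ B) (J : ClosedIdeal B) : ClosedIdeal A where
  carrier := {a | ∀ b : B, (φ a).fst b ∈ J ∧ (φ a).snd b ∈ J}
  zero_mem' := fun b => by
    simp only [map_zero, DoubleCentralizer.zero_fst, DoubleCentralizer.zero_snd]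
    exact ⟨J.toSubmodule.zero_mem, J.toSubmodule.zero_mem⟩
  add_mem' := fun {x y} hx hy b => by
    simp only [map_add, DoubleCentralizer.add_fst, DoubleCentralizer.add_snd]
    exact ⟨J.toSubmodule.add_mem (hx b).1 (hy b).1, J.toSubmodule.add_mem (hx b).2 (hy b).2⟩
  smul_mem' := fun c x hx b => by
    simp only [map_smul, DoubleCentralizer.smul_fst, DoubleCentralizer.smul_snd]
    exact ⟨J.toSubmodule.smul_mem c (hx b).1, J.toSubmodule.smul_mem c (hx b).2⟩
  isClosed' := by
    have hφ : Continuous φ :=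
      AddMonoidHomClass.continuous_of_bound φ 1 fun a => by
        simpa using NonUnitalStarAlgHom.norm_apply_le φ a
    have h₁ : ∀ b : B, Continuous fun a : A => (φ a).fst b := fun b => by
      have hL : LipschitzWith 1 fun m : DoubleCentralizer ℂ B => m.fst :=
        LipschitzWith.of_dist_le_mul fun x y => by
          rw [dist_eq_norm, dist_eq_norm, ← DoubleCentralizer.sub_fst,
            DoubleCentralizer.norm_fst]
          simp
      exact (ContinuousLinearMap.apply ℂ B b).continuous.comp (hL.continuous.comp hφ)
    have h₂ : ∀ b : B, Continuous fun a : A => (φ a).snd b := fun b => by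
      have hL : LipschitzWith 1 fun m : DoubleCentralizer ℂ B => m.snd :=
        LipschitzWith.of_dist_le_mul fun x y => by
          rw [dist_eq_norm, dist_eq_norm, ← DoubleCentralizer.sub_snd,
            DoubleCentralizer.norm_snd]
          simp
      exact (ContinuousLinearMap.apply ℂ B b).continuous.comp (hL.continuous.comp hφ)
    have : {a : A | ∀ b : B, (φ a).fst b ∈ J ∧ (φ a).snd b ∈ J} =
        ⋂ b : B, ((fun a : A => (φ a).fst b) ⁻¹' (J : Set B) ∩
          (fun a : A => (φ a).snd b) ⁻¹' (J : Set B)) := by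
      ext a
      simp
    change IsClosed {a : A | ∀ b : B, (φ a).fst b ∈ J ∧ (φ a).snd b ∈ J}
    rw [this]
    exact isClosed_iInter fun b =>
      (J.isClosed.preimage (h₁ b)).inter (J.isClosed.preimage (h₂ b))
  mul_mem_left' := fun a x hx b => by
    refine ⟨?_, ?_⟩
    · rw [map_mul, DoubleCentralizer.mul_fst]
      exact (multiplier_mem (φ a) J (hx b).1).1
    · rw [map_mul, DoubleCentralizer.mul_snd]
      exact (hx _).2
  mul_mem_right' := fun a x hx b => by
    refine ⟨?_, ?_⟩
    · rw [map_mul, DoubleCentralizer.mul_fst]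
      exact (hx _).1
    · rw [map_mul, DoubleCentralizer.mul_snd]
      exact (multiplier_mem (φ a) J (hx b).2).2

theorem mem_restrict {φ : A →⋆ₙₐ[ℂ] DoubleCentralizer ℂ B} {J : ClosedIdeal B} {a : A} :
    a ∈ restrict φ J ↔ ∀ b : B, (φ a).fst b ∈ J ∧ (φ a).snd b ∈ J := Iff.rfl

/-- The induced ideal `i(I) = B φ(I) B` of an ideal `I` of `A`: the closed linear span of the
elements `b₁ φ(x) b₂` with `x ∈ I` and `b₁, b₂ ∈ B`. -/
def induce (φ : A →⋆ₙₐ[ℂ] DoubleCentralizer ℂ B) (I : ClosedIdeal A) : ClosedIdeal B where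
  toSubmodule :=
    (Submodule.span ℂ {y : B | ∃ b₁ b₂ : B, ∃ x ∈ I, y = b₁ * (φ x).fst b₂}).topologicalClosure
  isClosed' := Submodule.isClosed_topologicalClosure _
  mul_mem_left' := fun a y hy => by
    refine map_mem_closure (continuous_const_mul a) hy fun z hz => ?_
    refine Submodule.span_induction ?_ ?_ ?_ ?_ hz
    · rintro _ ⟨b₁, b₂, x, hx, rfl⟩
      exact Submodule.subset_span ⟨a * b₁, b₂, x, hx, (mul_assoc _ _ _).symm⟩
    · simp
    · intro u v _ _ hu hv
      change a * (u + v) ∈ Submodule.span ℂ _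
      rw [mul_add]
      exact add_mem hu hv
    · intro c u _ hu
      change a * (c • u) ∈ Submodule.span ℂ _
      rw [mul_smul_comm]
      exact Submodule.smul_mem _ c hu
  mul_mem_right' := fun a y hy => by
    refine map_mem_closure (f := fun y => y * a) (continuous_mul_const a) hy fun z hz => ?_
    refine Submodule.span_induction ?_ ?_ ?_ ?_ hz
    · rintro _ ⟨b₁, b₂, x, hx, rfl⟩
      exact Submodule.subset_span ⟨b₁, b₂ * a, x, hx, by
        change b₁ * _ * a = _
        rw [mul_assoc, fst_mul]⟩
    · simp
    · intro u v _ _ hu hv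
      change (u + v) * a ∈ Submodule.span ℂ _
      rw [add_mul]
      exact add_mem hu hv
    · intro c u _ hu
      change (c • u) * a ∈ Submodule.span ℂ _
      rw [smul_mul_assoc]
      exact Submodule.smul_mem _ c hu

/-- An ideal of `A` is restricted if it is the restriction of some ideal of `B`. -/
def IsRestricted (φ : A →⋆ₙₐ[ℂ] DoubleCentralizer ℂ B) (I : ClosedIdeal A) : Prop :=
  ∃ J : ClosedIdeal B, restrict φ J = I

/-- An ideal of `B` is induced if it is induced by some ideal of `A`. -/
def IsInduced (φ : A →⋆ₙₐ[ℂ] DoubleCentralizer ℂ B) (J : ClosedIdeal B) : Prop :=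
  ∃ I : ClosedIdeal A, induce φ I = J

/-- The lattice of restricted ideals of `A`, ordered by inclusion. -/
abbrev RestrictedIdeal (φ : A →⋆ₙₐ[ℂ] DoubleCentralizer ℂ B) : Type u :=
  {I : ClosedIdeal A // IsRestricted φ I}

/-- The lattice of induced ideals of `B`, ordered by inclusion. -/
abbrev InducedIdeal (φ : A →⋆ₙₐ[ℂ] DoubleCentralizer ℂ B) : Type v :=
  {J : ClosedIdeal B // IsInduced φ J}

/-- The space of prime elements of the lattice of restricted ideals of `A`. -/
abbrev PrimeRestricted (φ : A →⋆ₙₐ[ℂ] DoubleCentralizer ℂ B) : Type u :=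
  PrimeSpace (RestrictedIdeal φ)

/-- The space of prime elements of the lattice of induced ideals of `B`. -/
abbrev PrimeInduced (φ : A →⋆ₙₐ[ℂ] DoubleCentralizer ℂ B) : Type v :=
  PrimeSpace (InducedIdeal φ)

/-- Joins of restricted ideals remain restricted. The join of the empty family, the zero ideal,
is included. -/
def JoinsRestricted (φ : A →⋆ₙₐ[ℂ] DoubleCentralizer ℂ B) : Prop :=
  ∀ S : Set (ClosedIdeal A), (∀ I ∈ S, IsRestricted φ I) → IsRestricted φ (sSup S)

theorem IsRestricted.inf {φ : A →⋆ₙₐ[ℂ] DoubleCentralizer ℂ B} {I₁ I₂ : ClosedIdeal A}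
    (h₁ : IsRestricted φ I₁) (h₂ : IsRestricted φ I₂) : IsRestricted φ (I₁ ⊓ I₂) := by
  obtain ⟨J₁, rfl⟩ := h₁
  obtain ⟨J₂, rfl⟩ := h₂
  refine ⟨J₁ ⊓ J₂, SetLike.ext fun a => ?_⟩
  simp only [mem_restrict, ClosedIdeal.mem_inf]
  exact ⟨fun h => ⟨fun b => ⟨(h b).1.1, (h b).2.1⟩, fun b => ⟨(h b).1.2, (h b).2.2⟩⟩,
    fun h b => ⟨⟨(h.1 b).1, (h.2 b).1⟩, ⟨(h.1 b).2, (h.2 b).2⟩⟩⟩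

theorem isRestricted_top (φ : A →⋆ₙₐ[ℂ] DoubleCentralizer ℂ B) : IsRestricted φ ⊤ :=
  ⟨⊤, top_le_iff.1 fun _ _ _ => ⟨ClosedIdeal.mem_top _, ClosedIdeal.mem_top _⟩⟩

/-- The join of all restricted ideals contained in `P`. -/
def restrictedCore (φ : A →⋆ₙₐ[ℂ] DoubleCentralizer ℂ B) (P : ClosedIdeal A) : ClosedIdeal A :=
  sSup {I | IsRestricted φ I ∧ I ≤ P}

/-- If joins of restricted ideals are restricted, then `restrictedCore φ P` is the largest
restricted ideal contained in `P`. -/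
theorem isGreatest_restrictedCore {φ : A →⋆ₙₐ[ℂ] DoubleCentralizer ℂ B}
    (hJR : JoinsRestricted φ) (P : ClosedIdeal A) :
    IsGreatest {I | IsRestricted φ I ∧ I ≤ P} (restrictedCore φ P) :=
  ⟨⟨hJR _ fun _ hI => hI.1, sSup_le fun _ hI => hI.2⟩, fun _ hI => le_sSup hI⟩

/-- The map `π` from the primitive ideal space of `A` to the space of prime elements of the lattice
of restricted ideals, which maps `P` to the largest restricted ideal contained in `P`. -/
def quasiOrbitProj (φ : A →⋆ₙₐ[ℂ] DoubleCentralizer ℂ B) (hJR : JoinsRestricted φ)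
    (P : PrimitiveSpace A) : PrimeRestricted φ :=
  ⟨⟨restrictedCore φ P.1, (isGreatest_restrictedCore hJR P.1).1.1⟩, by
    have hg := isGreatest_restrictedCore hJR P.1
    refine ⟨fun hmax => ?_, fun a b m hm hle => ?_⟩
    · have h : (⟨⊤, isRestricted_top φ⟩ : RestrictedIdeal φ) ≤ ⟨restrictedCore φ P.1, hg.1.1⟩ :=
        hmax (show restrictedCore φ P.1 ≤ ⊤ from le_top)
      have h' : (⊤ : ClosedIdeal A) ≤ restrictedCore φ P.1 := h
      exact P.2.ne_top (top_le_iff.1 (h'.trans hg.1.2))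
    · have h : (⟨a.1 ⊓ b.1, a.2.inf b.2⟩ : RestrictedIdeal φ) ≤ m :=
        hm.2 (by
          rintro c (rfl | rfl)
          · exact Subtype.coe_le_coe.1 inf_le_left
          · exact Subtype.coe_le_coe.1 inf_le_right)
      have h₁ : a.1 ⊓ b.1 ≤ m.1 := h
      have h₂ : m.1 ≤ restrictedCore φ P.1 := hle
      exact (P.2.le_or_le (h₁.trans (h₂.trans hg.1.2))).imp
        (fun ha => hg.2 ⟨a.2, ha⟩) (fun hb => hg.2 ⟨b.2, hb⟩)⟩

/-- The quasi-orbit space: the quotient of the primitive ideal space of `A` by the equivalence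
relation `P ∼ Q ↔ π P = π Q`, with the quotient topology. -/
abbrev QuasiOrbitSpace (φ : A →⋆ₙₐ[ℂ] DoubleCentralizer ℂ B) (hJR : JoinsRestricted φ) : Type u :=
  Quotient (Setoid.ker (quasiOrbitProj φ hJR))

end Galois

end QuasiOrbit

/-! Induction and restriction form a Galois connection, so `r ∘ i` is a closure operator on the
ideals of `A` whose closed elements are the restricted ideals. A restricted ideal lies in a
primitive ideal `P` iff it lies in `π P`, so the preimage under `π` of a basic open set is basic,
and `π` is continuous.

If `π` is open, then a primitive ideal outside the hull of `r(i(J))` shares its quasi-orbit with one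
outside the hull of `J`. Testing (C1) on primitive ideals and using that they are prime gives the
identity (`inf_restrict_induce_of_isOpenMap`).

For the converse, the claim is that `π` maps the open set of `J` onto that of `r(i(J))`. Given a
prime restricted `p` not above `J`, a primitive `P ⊇ p` is needed that contains neither `J` nor any
restricted ideal not below `p`. Countability reduces this to a sequence of restricted ideals `L n`
(`HasCountableSeparation`). By (C1) and primeness of `p`, the open set of each `L n` is dense in the
hull of `p`, so a Baire property of primitive ideals produces `P` (`exists_quasiOrbitProj_eq`).

That Baire property, `exists_primitive_of_dense`, is the analytic core. In the unitization,
successive cut-downs of an element of `J` outside `p` yield elements `g n` of `L n` and `J`;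
compactness yields a state vanishing on `p` with value one at every `g n`; an extreme point of the
set of such states has an irreducible GNS representation, whose kernel on `A` is `P`.

Finally, an open continuous surjection is a quotient map, and the lattices of restricted and induced
ideals are isomorphic. -/

namespace QuasiOrbit

open scoped ComplexOrder

universe u v

/-! ### Elementary closure properties of closed ideals. -/

namespace ClosedIdeal

instance {A : Type u} [NonUnitalCStarAlgebra A] : AddSubgroupClass (ClosedIdeal A) A where
  add_mem {I} _ _ hx hy := I.toSubmodule.add_mem hx hy
  zero_mem I := I.toSubmodule.zero_mem
  neg_mem {I} _ hx := I.toSubmodule.neg_mem hx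

instance {A : Type u} [NonUnitalCStarAlgebra A] : SMulMemClass (ClosedIdeal A) ℂ A where
  smul_mem {I} c _ hx := I.toSubmodule.smul_mem c hx

theorem real_smul_mem {A : Type u} [NonUnitalCStarAlgebra A] (I : ClosedIdeal A) (r : ℝ) {x : A}
    (hx : x ∈ I) : r • x ∈ I := by
  rw [← Complex.coe_smul]
  exact SMulMemClass.smul_mem _ hx

/-- An element that is approximated by elements of a closed ideal belongs to it. -/
theorem mem_of_forall_norm_sub_le {A : Type u} [NonUnitalCStarAlgebra A] (I : ClosedIdeal A)
    {x : A} (h : ∀ ε > 0, ∃ y ∈ I, ‖x - y‖ ≤ ε) : x ∈ I := by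
  have : x ∈ closure (I : Set A) := Metric.mem_closure_iff.2 fun ε hε => by
    obtain ⟨y, hy, hxy⟩ := h (ε / 2) (half_pos hε)
    exact ⟨y, hy, by rw [dist_eq_norm]; linarith⟩
  rwa [I.isClosed.closure_eq] at this

end ClosedIdeal

/-! ### Cut-downs of positive elements, and positive functionals that vanish on an ideal. -/

section Unital

variable {D : Type u} [CStarAlgebra D] [PartialOrder D] [StarOrderedRing D]

/-- A positive element `c` has a local unit `g = c * k` for its cut-down `c - δ • g`. -/
theorem exists_cutoff {c : D} (hc : 0 ≤ c) {δ : ℝ} (hδ : 0 < δ) :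
    ∃ k g : D, g = c * k ∧ 0 ≤ g ∧ g ≤ 1 ∧ g * (c - δ • g) = c - δ • g ∧
      ‖(1 - g) * c * (1 - g)‖ ≤ δ := by
  have hsa : IsSelfAdjoint c := .of_nonneg hc
  have hm : ∀ t : ℝ, max δ t ≠ 0 := fun t => (lt_max_of_lt_left hδ).ne'
  have hcont : Continuous fun t : ℝ => (max δ t)⁻¹ :=
    (continuous_const.max continuous_id).inv₀ hm
  -- `G t = min (t / δ) 1`, so `t - δ * G t` is the positive part of `t - δ`, where `G = 1`. The
  -- factorization `G t = t * K t` keeps `g` in every ideal that contains `c`.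
  set K : ℝ → ℝ := fun t => (max δ t)⁻¹ with hK
  set G : ℝ → ℝ := fun t => t * K t with hG
  have hGc : Continuous G := continuous_id.mul hcont
  have hpos : ∀ t ∈ spectrum ℝ c, 0 ≤ t := fun t ht => spectrum_nonneg_of_nonneg hc ht
  have hle : ∀ t, 0 ≤ t → 0 ≤ G t ∧ G t ≤ 1 := fun t ht => by
    have h0 : 0 < max δ t := lt_max_of_lt_left hδ
    refine ⟨mul_nonneg ht (inv_nonneg.2 h0.le), ?_⟩
    rw [hG]
    change t * (max δ t)⁻¹ ≤ 1
    rw [← div_eq_mul_inv, div_le_one h0]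
    exact le_max_right _ _
  have hcid : cfc (fun t : ℝ => t) c = c := cfc_id' ℝ c
  have hsub : c - δ • cfc G c = cfc (fun t => t - δ * G t) c := by
    rw [cfc_sub (fun t : ℝ => t) (fun t => δ * G t) c continuousOn_id
      (continuous_const.mul hGc).continuousOn, cfc_const_mul δ G c hGc.continuousOn, hcid]
  refine ⟨cfc K c, cfc G c, ?_, cfc_nonneg fun t ht => (hle t (hpos t ht)).1,
    cfc_le_one G c fun t ht => (hle t (hpos t ht)).2, ?_, ?_⟩
  · rw [hG, cfc_mul (fun t : ℝ => t) K c continuousOn_id hcont.continuousOn, hcid]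
  · rw [hsub, ← cfc_mul G (fun t => t - δ * G t) c hGc.continuousOn
      (continuous_id.sub (continuous_const.mul hGc)).continuousOn]
    refine cfc_congr fun t _ => ?_
    rcases le_total δ t with h | h
    · have : G t = 1 := by
        rw [hG, hK]
        change t * (max δ t)⁻¹ = 1
        rw [max_eq_right h, mul_inv_cancel₀ (hδ.trans_le h).ne']
      simp [this]
    · have : δ * G t = t := by
        rw [hG, hK]
        change δ * (t * (max δ t)⁻¹) = t
        rw [max_eq_left h]
        field_simp
      simp [this]
  · have h1 : (1 : D) - cfc G c = cfc (fun t => 1 - G t) c := by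
      rw [cfc_sub (fun _ : ℝ => 1) G c continuousOn_const hGc.continuousOn, cfc_const_one ℝ c]
    have h2 : (1 - cfc G c) * c * (1 - cfc G c) =
        cfc (fun t => (1 - G t) * t * (1 - G t)) c := by
      rw [cfc_mul (fun t => (1 - G t) * t) (fun t => 1 - G t) c
          ((continuous_const.sub hGc).mul continuous_id).continuousOn
          (continuous_const.sub hGc).continuousOn,
        cfc_mul (fun t => 1 - G t) (fun t : ℝ => t) c
          (continuous_const.sub hGc).continuousOn continuousOn_id, hcid, h1]
    rw [h2]
    refine norm_cfc_le hδ.le fun t ht => ?_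
    have ht0 := hpos t ht
    obtain ⟨hG0, hG1⟩ := hle t ht0
    rw [Real.norm_of_nonneg (mul_nonneg (mul_nonneg (by linarith) ht0) (by linarith))]
    rcases le_total δ t with h | h
    · have : G t = 1 := by
        rw [hG, hK]
        change t * (max δ t)⁻¹ = 1
        rw [max_eq_right h, mul_inv_cancel₀ (hδ.trans_le h).ne']
      simp [this, hδ.le]
    · calc (1 - G t) * t * (1 - G t) ≤ 1 * δ * 1 := by gcongr <;> linarith
        _ = δ := by ring

namespace ClosedIdeal

/-- If `star y * y` is dominated by a positive element of a closed ideal up to arbitrarily small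
scalars, then `y` belongs to the ideal. -/
theorem mem_of_forall_star_mul_self_le (p : ClosedIdeal D) {y : D}
    (h : ∀ ε > 0, ∃ k ∈ p, 0 ≤ k ∧ star y * y ≤ algebraMap ℝ D ε + k) : y ∈ p := by
  refine p.mem_of_forall_norm_sub_le fun ε hε => ?_
  have hε2 : 0 < ε ^ 2 / 2 := by positivity
  obtain ⟨k, hk, hk0, hle⟩ := h _ hε2
  -- Since `g` is almost a unit for `k`, conjugating the bound on `star y * y` by `1 - g` shows that
  -- `y * g ∈ p` is close to `y`. The two summands `ε ^ 2 / 2` come from the scalar and from `k`.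
  obtain ⟨m, g, hg, hg0, hg1, -, hn⟩ := exists_cutoff hk0 hε2
  have hgp : g ∈ p := hg ▸ p.mul_mem_right m hk
  have hgs : IsSelfAdjoint (1 - g) := (IsSelfAdjoint.one D).sub (.of_nonneg hg0)
  have hg2 : ‖1 - g‖ ≤ 1 :=
    (CStarAlgebra.norm_le_one_iff_of_nonneg _ (sub_nonneg.2 hg1)).2 (by simpa using hg0)
  refine ⟨y * g, p.mul_mem_left y hgp, ?_⟩
  have h1 : star (y - y * g) * (y - y * g) = star (1 - g) * (star y * y) * (1 - g) := by
    have : y - y * g = y * (1 - g) := by rw [mul_sub, mul_one]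
    rw [this, star_mul]
    simp only [mul_assoc]
  have h2 : ‖star (y - y * g) * (y - y * g)‖ ≤ ε ^ 2 := by
    calc ‖star (y - y * g) * (y - y * g)‖
        ≤ ‖star (1 - g) * (algebraMap ℝ D (ε ^ 2 / 2) + k) * (1 - g)‖ := by
          refine CStarAlgebra.norm_le_norm_of_nonneg_of_le (star_mul_self_nonneg _) ?_
          rw [h1]
          exact star_left_conjugate_le_conjugate hle _
      _ = ‖(ε ^ 2 / 2) • ((1 - g) * (1 - g)) + (1 - g) * k * (1 - g)‖ := by
          rw [hgs.star_eq, Algebra.algebraMap_eq_smul_one, mul_add, add_mul, mul_smul_comm,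
            smul_mul_assoc, mul_one]
      _ ≤ ‖(ε ^ 2 / 2) • ((1 - g) * (1 - g))‖ + ‖(1 - g) * k * (1 - g)‖ := norm_add_le _ _
      _ ≤ ε ^ 2 / 2 * 1 + ε ^ 2 / 2 := by
          refine add_le_add ?_ hn
          rw [norm_smul, Real.norm_of_nonneg hε2.le]
          refine mul_le_mul_of_nonneg_left ?_ hε2.le
          calc _ ≤ ‖1 - g‖ * ‖1 - g‖ := norm_mul_le _ _
            _ ≤ 1 * 1 := by gcongr
            _ = 1 := one_mul _
      _ = ε ^ 2 := by ring
  rw [CStarRing.norm_star_mul_self, ← sq] at h2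
  exact le_of_sq_le_sq h2 hε.le

/-- This yields self-adjointness of closed ideals without approximate units. -/
theorem mem_of_star_mul_self_mem (p : ClosedIdeal D) {y : D} (h : star y * y ∈ p) : y ∈ p :=
  p.mem_of_forall_star_mul_self_le fun ε hε => ⟨_, h, star_mul_self_nonneg y, by
    simpa using (algebraMap_nonneg D hε.le)⟩

theorem star_mem (p : ClosedIdeal D) {x : D} (h : x ∈ p) : star x ∈ p := by
  refine p.mem_of_star_mul_self_mem (y := star x) ?_
  rw [star_star]
  exact p.mul_mem_right _ h

end ClosedIdeal

/-- Positive functionals vanishing on a closed ideal detect the elements outside of it. -/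
theorem exists_positive_functional (p : ClosedIdeal D) {y : D} (hy : y ∉ p) :
    ∃ f : D →L[ℂ] ℂ, (∀ x, 0 ≤ x → 0 ≤ f x) ∧ (∀ q ∈ p, f q = 0) ∧ f (star y * y) ≠ 0 := by
  have hy' : ∃ ε > 0, ∀ k ∈ p, 0 ≤ k → ¬ star y * y ≤ algebraMap ℝ D ε + k := by
    by_contra! h
    exact hy (p.mem_of_forall_star_mul_self_le h)
  obtain ⟨ε, hε, hk⟩ := hy'
  -- The real cone of elements whose real part is positive modulo `p`; a functional that separates
  -- it from a ball around `-(star y * y)` is the real part of the desired one.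
  let C : Set D := {x | ∃ q ∈ p, 0 ≤ x + star x + q}
  have hCconv : Convex ℝ C := by
    rintro x ⟨q, hq, hx⟩ z ⟨r, hr, hz⟩ s t hs ht -
    refine ⟨s • q + t • r, add_mem (p.real_smul_mem s hq) (p.real_smul_mem t hr), ?_⟩
    have := add_nonneg (smul_nonneg hs hx) (smul_nonneg ht hz)
    have e : s • x + t • z + star (s • x + t • z) + (s • q + t • r) =
        s • (x + star x + q) + t • (z + star z + r) := by
      simp only [star_add, star_smul, star_trivial, smul_add]
      abel
    rwa [e]
  have hCsmul : ∀ x ∈ C, ∀ s : ℝ, 0 ≤ s → s • x ∈ C := by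
    rintro x ⟨q, hq, hx⟩ s hs
    refine ⟨s • q, p.real_smul_mem s hq, ?_⟩
    have := smul_nonneg hs hx
    simpa only [star_smul, star_trivial, smul_add] using this
  have hdisj : Disjoint (Metric.ball (-(star y * y)) (ε / 2)) C := by
    refine Set.disjoint_left.2 ?_
    rintro z hz ⟨q, hq, hzq⟩
    rw [Metric.mem_ball, dist_eq_norm, sub_neg_eq_add] at hz
    have hsa : IsSelfAdjoint (z + star z) := IsSelfAdjoint.add_star_self z
    have hqs : IsSelfAdjoint q := by
      have := (IsSelfAdjoint.of_nonneg hzq).sub hsa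
      simpa using this
    have hws : IsSelfAdjoint (z + star y * y + star (z + star y * y)) :=
      IsSelfAdjoint.add_star_self _
    have hw : z + star y * y + star (z + star y * y) ≤ algebraMap ℝ D ε := by
      refine hws.le_algebraMap_norm_self.trans ?_
      refine algebraMap_mono D ((norm_add_le _ _).trans ?_)
      rw [norm_star]
      linarith
    have h2 : star y * y + star y * y ≤ algebraMap ℝ D ε + q := by
      have e : z + star y * y + star (z + star y * y) =
          (z + star z + q) + (star y * y + star y * y) - q := by
        simp only [star_add, star_mul, star_star]
        abel
      rw [e, sub_le_iff_le_add] at hw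
      exact (le_add_of_nonneg_left hzq).trans hw
    -- Expand `(ε - q) ^ 2 ≥ 0`. This trades the self-adjoint `q` for the positive element `q * q`,
    -- still in `p`, as the choice of `ε` requires.
    have h3 : q + q ≤ algebraMap ℝ D ε + ε⁻¹ • (q * q) := by
      have := smul_nonneg (inv_nonneg.2 hε.le) (star_mul_self_nonneg (algebraMap ℝ D ε - q))
      rw [((IsSelfAdjoint.algebraMap D (IsSelfAdjoint.all ε)).sub hqs).star_eq,
        Algebra.algebraMap_eq_smul_one] at this
      rw [Algebra.algebraMap_eq_smul_one, ← sub_nonneg]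
      convert this using 1
      simp only [mul_sub, sub_mul, smul_mul_assoc, mul_smul_comm, one_mul, mul_one, smul_sub,
        smul_smul]
      rw [inv_mul_cancel₀ hε.ne', ← mul_assoc, inv_mul_cancel₀ hε.ne', one_mul, one_smul]
      abel
    have hqq : 0 ≤ q * q := by simpa [hqs.star_eq] using star_mul_self_nonneg q
    refine hk ((4 * ε)⁻¹ • (q * q)) (p.real_smul_mem _ (p.mul_mem_left q hq))
      (smul_nonneg (by positivity) hqq) ?_
    have h4 : (4 : ℝ) • (star y * y) ≤
        (4 : ℝ) • (algebraMap ℝ D ε + (4 * ε)⁻¹ • (q * q)) := by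
      have h5 := (add_le_add h2 h2).trans
        (show algebraMap ℝ D ε + q + (algebraMap ℝ D ε + q) ≤
          algebraMap ℝ D ε + algebraMap ℝ D ε + (algebraMap ℝ D ε + ε⁻¹ • (q * q)) by
            rw [add_add_add_comm]
            exact add_le_add_right h3 _)
      have h6 : (0 : D) ≤ algebraMap ℝ D ε := algebraMap_nonneg D hε.le
      have e1 : (4 : ℝ) • (star y * y) =
          star y * y + star y * y + (star y * y + star y * y) := by module
      have e2 : (4 : ℝ) • (algebraMap ℝ D ε + (4 * ε)⁻¹ • (q * q)) =
          algebraMap ℝ D ε + algebraMap ℝ D ε + (algebraMap ℝ D ε + ε⁻¹ • (q * q)) +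
            algebraMap ℝ D ε := by
        rw [smul_add, smul_smul, mul_inv, mul_inv_cancel_left₀ (by norm_num)]
        module
      rw [e1, e2]
      exact h5.trans (le_add_of_nonneg_right h6)
    exact (smul_le_smul_iff_of_pos_left (by norm_num)).1 h4
  obtain ⟨l, s, hl1, hl2⟩ := geometric_hahn_banach_open (convex_ball _ _) Metric.isOpen_ball
    hCconv hdisj
  have hC0 : ∀ x : D, 0 ≤ x + star x → x ∈ C := fun x hx => ⟨0, zero_mem p, by simpa using hx⟩
  have hs : s ≤ 0 := by simpa using hl2 0 (hC0 0 (by simp))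
  have hlC : ∀ x ∈ C, 0 ≤ l x := by
    intro x hx
    by_contra! hneg
    -- The multiple of `x` is chosen so that `l` takes the value `s - 1 < s` on it.
    have h1 := hl2 _ (hCsmul x hx ((s - 1) / l x)
      (div_nonneg_of_nonpos (by linarith) hneg.le))
    rw [map_smul, smul_eq_mul, div_mul_cancel₀ _ hneg.ne] at h1
    linarith
  have hlskew : ∀ x : D, x + star x = 0 → l x = 0 := fun x hx => by
    have h1 := hlC x (hC0 x hx.ge)
    have h2 := hlC (-x) (hC0 (-x) (by rw [star_neg, ← neg_add, hx, neg_zero]))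
    rw [map_neg] at h2
    linarith
  have hlp : ∀ q ∈ p, l q = 0 := by
    have : ∀ q ∈ p, 0 ≤ l q := fun q hq => hlC q
      ⟨-(q + star q), neg_mem (add_mem hq (p.star_mem hq)), by simp⟩
    intro q hq
    have h1 := this q hq
    have h2 := this (-q) (neg_mem hq)
    rw [map_neg] at h2
    linarith
  have hf : ∀ x, StrongDual.extendRCLike (𝕜 := ℂ) l x = l x - Complex.I * l (Complex.I • x) :=
    fun x => StrongDual.extendRCLike_apply l x
  have hfpos : ∀ x, 0 ≤ x → StrongDual.extendRCLike (𝕜 := ℂ) l x = l x := fun x hx => by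
    rw [hf, hlskew (Complex.I • x)]
    · simp
    · rw [star_smul, (IsSelfAdjoint.of_nonneg hx).star_eq]
      simp
  refine ⟨StrongDual.extendRCLike (𝕜 := ℂ) l, fun x hx => ?_, fun q hq => ?_, ?_⟩
  · rw [hfpos x hx, Complex.zero_le_real]
    exact hlC x (hC0 x (by rw [(IsSelfAdjoint.of_nonneg hx).star_eq]; exact add_nonneg hx hx))
  · rw [hf, hlp q hq, hlp _ (SMulMemClass.smul_mem Complex.I hq)]
    simp
  · rw [hfpos _ (star_mul_self_nonneg y)]
    have := hl1 _ (Metric.mem_ball_self (half_pos hε))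
    rw [map_neg] at this
    exact Complex.ofReal_ne_zero.2 (by linarith : 0 < l (star y * y)).ne'

end Unital

/-! ### States vanishing on an ideal, their GNS representations, and purity of extreme points. -/

section States

open scoped InnerProductSpace

variable {D : Type u} [CStarAlgebra D] [PartialOrder D]

/-- The states of `D` that vanish on the ideal `p`. -/
def annihilatingStates (p : ClosedIdeal D) : Set (WeakDual ℂ D) :=
  {f | f 1 = 1 ∧ (∀ x, 0 ≤ x → 0 ≤ f x) ∧ ∀ q ∈ p, f q = 0}

theorem isClosed_annihilatingStates (p : ClosedIdeal D) : IsClosed (annihilatingStates p) := by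
  have : annihilatingStates p = {f : WeakDual ℂ D | f 1 = 1} ∩
      ((⋂ x : {x : D // 0 ≤ x}, {f : WeakDual ℂ D | 0 ≤ f x.1}) ∩
        ⋂ q : p, {f : WeakDual ℂ D | f q.1 = 0}) := by
    ext f
    simp [annihilatingStates]
  rw [this]
  refine (isClosed_eq (WeakDual.eval_continuous _) continuous_const).inter
    ((isClosed_iInter fun x => ?_).inter (isClosed_iInter fun q => ?_))
  · exact isClosed_le continuous_const (WeakDual.eval_continuous _)
  · exact isClosed_eq (WeakDual.eval_continuous _) continuous_const

variable [StarOrderedRing D]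

/-- The Gelfand–Naimark–Segal representation of a positive functional on a unital C*-algebra,
together with its cyclic vector. -/
theorem exists_cyclic_representation (f : D →L[ℂ] ℂ) (hf : ∀ x, 0 ≤ x → 0 ≤ f x) :
    ∃ (H : Type u) (_ : NormedAddCommGroup H) (_ : InnerProductSpace ℂ H) (_ : CompleteSpace H)
      (ρ : D →⋆ₐ[ℂ] (H →L[ℂ] H)) (ξ : H),
      (∀ x, ⟪ξ, ρ x ξ⟫_ℂ = f x) ∧ DenseRange fun x => ρ x ξ := by
  let F : D →ₚ[ℂ] ℂ := PositiveLinearMap.mk₀ f.toLinearMap hf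
  have hv : ∀ x : D, F.gnsStarAlgHom x ((F.toPreGNS 1 : F.PreGNS) : F.GNS) =
      ((F.toPreGNS x : F.PreGNS) : F.GNS) := fun x => by
    change F.gnsNonUnitalStarAlgHom x _ = _
    rw [PositiveLinearMap.gnsNonUnitalStarAlgHom_apply_coe]
    simp
  refine ⟨F.GNS, inferInstance, inferInstance, inferInstance, F.gnsStarAlgHom,
    ((F.toPreGNS 1 : F.PreGNS) : F.GNS), fun x => ?_, ?_⟩
  · rw [hv, UniformSpace.Completion.inner_coe, PositiveLinearMap.preGNS_inner_def]
    simp only [PositiveLinearMap.ofPreGNS_toPreGNS, star_one, one_mul]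
    rfl
  · have : (fun x => F.gnsStarAlgHom x ((F.toPreGNS 1 : F.PreGNS) : F.GNS)) =
        (fun y : F.PreGNS => (y : F.GNS)) ∘ F.toPreGNS := funext hv
    rw [this]
    exact UniformSpace.Completion.denseRange_coe.comp F.toPreGNS.surjective.denseRange
      (UniformSpace.Completion.continuous_coe _)

/-- In the GNS representation `f` is the vector state of a unit vector, and representations are
contractive. -/
theorem norm_apply_le_of_mem_annihilatingStates {p : ClosedIdeal D} {f : WeakDual ℂ D}
    (hf : f ∈ annihilatingStates p) (x : D) : ‖f x‖ ≤ ‖x‖ := by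
  obtain ⟨h1, hpos, -⟩ := hf
  obtain ⟨H, _, _, _, ρ, ξ, hρ, -⟩ := exists_cyclic_representation (WeakDual.toStrongDual f) hpos
  have hξ : ‖ξ‖ ^ 2 = 1 := by
    have h := hρ 1
    rw [map_one, one_apply_eq_self, inner_self_eq_norm_sq_to_K] at h
    have h' : ((‖ξ‖ : ℂ)) ^ 2 = 1 := h.trans h1
    exact_mod_cast h'
  calc ‖f x‖ = ‖⟪ξ, ρ x ξ⟫_ℂ‖ := by rw [hρ]; rfl
    _ ≤ ‖ξ‖ * ‖ρ x ξ‖ := norm_inner_le_norm _ _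
    _ ≤ ‖ξ‖ * (‖ρ x‖ * ‖ξ‖) := by gcongr; exact (ρ x).le_opNorm ξ
    _ = ‖ρ x‖ * ‖ξ‖ ^ 2 := by ring
    _ ≤ ‖x‖ := by
      rw [hξ, mul_one]
      exact NonUnitalStarAlgHom.norm_apply_le ρ x

/-- Banach–Alaoglu: a weak-* closed subset of the unit ball. -/
theorem isCompact_annihilatingStates (p : ClosedIdeal D) : IsCompact (annihilatingStates p) := by
  refine (WeakDual.isCompact_closedBall (0 : StrongDual ℂ D) 1).of_isClosed_subset
    (isClosed_annihilatingStates p) fun f hf => ?_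
  simp only [Set.mem_preimage, mem_closedBall_zero_iff]
  exact ContinuousLinearMap.opNorm_le_bound _ zero_le_one fun x => by
    rw [one_mul]
    exact norm_apply_le_of_mem_annihilatingStates hf x

/-- The vector state `x ↦ ⟪η, ρ x η⟫ / ‖η‖ ^ 2`. -/
theorem vectorState_mem_annihilatingStates {p : ClosedIdeal D} {H : Type*}
    [NormedAddCommGroup H] [InnerProductSpace ℂ H] [CompleteSpace H]
    (ρ : D →⋆ₐ[ℂ] (H →L[ℂ] H)) {η : H} (hη : η ≠ 0) (hp : ∀ q ∈ p, ρ q η = 0) :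
    ∃ f ∈ annihilatingStates p, ∀ x, f x = ⟪η, ρ x η⟫_ℂ / ‖η‖ ^ 2 := by
  have hρ : Continuous fun x => ρ x :=
    AddMonoidHomClass.continuous_of_bound ρ 1 fun x => by
      simpa using NonUnitalStarAlgHom.norm_apply_le ρ x
  let f : D →L[ℂ] ℂ :=
    { toFun := fun x => ⟪η, ρ x η⟫_ℂ / ‖η‖ ^ 2
      map_add' := fun x y => by
        rw [map_add, add_apply, inner_add_right, add_div]
      map_smul' := fun c x => by
        simp [map_smul, mul_div_assoc]
      cont := ((continuous_const.inner
        ((ContinuousLinearMap.apply ℂ H η).continuous.comp hρ))).div_const _ }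
  have hη' : (‖η‖ : ℂ) ≠ 0 := by simpa using hη
  refine ⟨StrongDual.toWeakDual f, ⟨?_, fun x hx => ?_, fun q hq => ?_⟩, fun x => rfl⟩
  · change ⟪η, ρ 1 η⟫_ℂ / ‖η‖ ^ 2 = 1
    rw [map_one, one_apply_eq_self, inner_self_eq_norm_sq_to_K]
    exact div_self (pow_ne_zero 2 hη')
  · change 0 ≤ ⟪η, ρ x η⟫_ℂ / ‖η‖ ^ 2
    obtain ⟨b, rfl⟩ := CStarAlgebra.nonneg_iff_eq_star_mul_self.1 hx
    rw [map_mul, map_star, ContinuousLinearMap.star_eq_adjoint, mul_apply_eq_comp,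
      ContinuousLinearMap.adjoint_inner_right, inner_self_eq_norm_sq_to_K]
    have : ((‖ρ b η‖ : ℂ)) ^ 2 / (‖η‖ : ℂ) ^ 2 = ((‖ρ b η‖ ^ 2 / ‖η‖ ^ 2 : ℝ) : ℂ) := by
      push_cast
      rfl
    refine le_of_le_of_eq ?_ this.symm
    exact Complex.zero_le_real.2 (by positivity)
  · change ⟪η, ρ q η⟫_ℂ / ‖η‖ ^ 2 = 0
    rw [hp q hq, inner_zero_right, zero_div]

/-- Extreme points of the face of states that are one on given elements `0 ≤ g i ≤ 1` are pure:
their cyclic representations are irreducible. -/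
theorem eq_bot_or_eq_top_of_mem_extremePoints {p : ClosedIdeal D} {ι : Type*} {g : ι → D}
    (hg1 : ∀ i, g i ≤ 1) {f : WeakDual ℂ D}
    (hf : f ∈ Set.extremePoints ℝ {f ∈ annihilatingStates p | ∀ i, f (g i) = 1})
    {H : Type*} [NormedAddCommGroup H] [InnerProductSpace ℂ H] [CompleteSpace H]
    (ρ : D →⋆ₐ[ℂ] (H →L[ℂ] H)) {ξ : H} (hρ : ∀ x, ⟪ξ, ρ x ξ⟫_ℂ = f x)
    (hξ : DenseRange fun x => ρ x ξ) (hp : ∀ q ∈ p, ρ q = 0)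
    (K : Submodule ℂ H) (hK : IsClosed (K : Set H)) (hinv : ∀ a, ∀ x ∈ K, ρ a x ∈ K) :
    K = ⊥ ∨ K = ⊤ := by
  have : CompleteSpace K := hK.completeSpace_coe
  have hinv' : ∀ a, ∀ x ∈ Kᗮ, ρ a x ∈ Kᗮ := fun a x hx y hy => by
    have h := hx _ (hinv (star a) y hy)
    rwa [map_star, ContinuousLinearMap.star_eq_adjoint,
      ContinuousLinearMap.adjoint_inner_left] at h
  obtain ⟨η, hη, ζ, hζ, hsum⟩ := K.exists_add_mem_mem_orthogonal ξ
  have hdecomp : ∀ x, f x = ⟪η, ρ x η⟫_ℂ + ⟪ζ, ρ x ζ⟫_ℂ := fun x => by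
    rw [← hρ, hsum, map_add, inner_add_left, inner_add_right, inner_add_right,
      hinv' x ζ hζ η hη, K.inner_left_of_mem_orthogonal (hinv x η hη) hζ]
    ring
  rcases eq_or_ne η 0 with h0 | hη0
  · left
    rw [h0, zero_add] at hsum
    have : ∀ z, z ∈ Kᗮ := fun z => by
      refine hξ.induction_on z (Submodule.isClosed_orthogonal K) fun x => ?_
      rw [hsum]
      exact hinv' x ζ hζ
    refine (Submodule.eq_bot_iff _).2 fun z hz => ?_
    exact inner_self_eq_zero.1 (this z z hz)
  rcases eq_or_ne ζ 0 with h0 | hζ0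
  · right
    rw [h0, add_zero] at hsum
    refine Submodule.eq_top_iff'.2 fun z => ?_
    refine hξ.induction_on z hK fun x => ?_
    rw [hsum]
    exact hinv x η hη
  exfalso
  obtain ⟨f₁, hf₁, hf₁v⟩ := vectorState_mem_annihilatingStates (p := p) ρ hη0
    fun q hq => by rw [hp q hq, zero_apply]
  obtain ⟨f₂, hf₂, hf₂v⟩ := vectorState_mem_annihilatingStates (p := p) ρ hζ0
    fun q hq => by rw [hp q hq, zero_apply]
  have hη1 : 0 < ‖η‖ ^ 2 := by positivity
  have hζ1 : 0 < ‖ζ‖ ^ 2 := by positivity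
  have hcomb : ∀ x, f x = (‖η‖ ^ 2 : ℝ) * f₁ x + (‖ζ‖ ^ 2 : ℝ) * f₂ x := fun x => by
    have e1 : (‖η‖ : ℂ) ^ 2 ≠ 0 := by simpa using hη0
    have e2 : (‖ζ‖ : ℂ) ^ 2 ≠ 0 := by simpa using hζ0
    rw [hf₁v, hf₂v, hdecomp]
    push_cast
    rw [mul_div_cancel₀ _ e1, mul_div_cancel₀ _ e2]
  have hone : ‖η‖ ^ 2 + ‖ζ‖ ^ 2 = 1 := by
    have h := hcomb 1
    rw [hf.1.1.1, hf₁.1, hf₂.1, mul_one, mul_one] at h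
    exact_mod_cast h.symm
  -- both vector states lie in the face, since `1` is extreme among the possible values
  have hle : ∀ f' ∈ annihilatingStates p, ∀ i, f' (g i) ≤ 1 := fun f' hf' i => by
    have h := hf'.2.1 _ (sub_nonneg.2 (hg1 i))
    rw [map_sub, hf'.1] at h
    exact sub_nonneg.1 h
  have hface : (∀ i, f₁ (g i) = 1) ∧ ∀ i, f₂ (g i) = 1 := by
    rw [← forall_and]
    intro i
    have h1 := Complex.le_def.1 (hle f₁ hf₁ i)
    have h2 := Complex.le_def.1 (hle f₂ hf₂ i)
    have h := congrArg Complex.re (hcomb (g i))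
    rw [hf.1.2 i, Complex.add_re, Complex.re_ofReal_mul, Complex.re_ofReal_mul] at h
    have h1' := h1.1
    have h2' := h2.1
    rw [Complex.one_re] at h h1' h2'
    constructor
    · exact Complex.ext (by rw [Complex.one_re]; nlinarith) h1.2
    · exact Complex.ext (by rw [Complex.one_re]; nlinarith) h2.2
  -- Extremality identifies the normalized vector state of `η` with `f`. By cyclicity `η` is then a
  -- multiple of `ξ`, which puts `ξ`, and hence `ζ`, in `K`.
  have hext := (mem_extremePoints.1 hf).2 f₁ ⟨hf₁, hface.1⟩ f₂ ⟨hf₂, hface.2⟩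
    ⟨‖η‖ ^ 2, ‖ζ‖ ^ 2, hη1, hζ1, hone, by
      refine DFunLike.ext _ _ fun x => ?_
      rw [hcomb x]
      change (‖η‖ ^ 2 : ℝ) • f₁ x + (‖ζ‖ ^ 2 : ℝ) • f₂ x = _
      rw [Complex.real_smul, Complex.real_smul]⟩
  have hfeq : ∀ x, ⟪η, ρ x ξ⟫_ℂ = (‖η‖ ^ 2 : ℝ) * ⟪ξ, ρ x ξ⟫_ℂ := fun x => by
    have e1 : (‖η‖ : ℂ) ^ 2 ≠ 0 := by simpa using hη0
    have h := hf₁v x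
    rw [hext.1, eq_div_iff e1] at h
    rw [hρ, mul_comm]
    push_cast
    rw [h, hsum, map_add, inner_add_right, hinv' x ζ hζ η hη, add_zero]
  have hperp : ∀ z, ⟪η - (‖η‖ ^ 2 : ℝ) • ξ, z⟫_ℂ = 0 := fun z => by
    refine hξ.induction_on z (isClosed_eq (continuous_const.inner continuous_id)
      continuous_const) fun x => ?_
    rw [inner_sub_left, hfeq, RCLike.real_smul_eq_coe_smul (K := ℂ), inner_smul_left]
    simp
  have hηξ : η = (‖η‖ ^ 2 : ℝ) • ξ := sub_eq_zero.1 (inner_self_eq_zero.1 (hperp _))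
  have hξK : ξ ∈ K := by
    have : ξ = (‖η‖ ^ 2)⁻¹ • η := ((inv_smul_eq_iff₀ hη1.ne').2 hηξ).symm
    rw [this, RCLike.real_smul_eq_coe_smul (K := ℂ)]
    exact K.smul_mem _ hη
  have hζK : ζ ∈ K := by
    have : ζ = ξ - η := by rw [hsum]; abel
    rw [this]
    exact K.sub_mem hξK hη
  exact hζ0 (inner_self_eq_zero.1 (hζ ζ hζK))

end States

/-! ### Baire category argument in a unital C*-algebra. -/

section LocalUnits

variable {D : Type u} [CStarAlgebra D] [PartialOrder D] [StarOrderedRing D]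

/-- If `d ∉ p` and `x * d ∉ p` with `x ∈ L`, then `d` can be cut down to an element outside of `p`
that has a local unit in `L`. -/
theorem exists_local_unit (p L : ClosedIdeal D) {d x : D} (hd : IsSelfAdjoint d) (hx : x ∈ L)
    (hxd : x * d ∉ p) :
    ∃ d' g : D, IsSelfAdjoint d' ∧ d' ∉ p ∧ g ∈ L ∧ g ≤ 1 ∧ g * d' = d' ∧
      (∃ z, d' = d * z) ∧ ∃ w, g = d * w := by
  set c : D := star (x * d) * (x * d) with hc
  have hc0 : 0 ≤ c := star_mul_self_nonneg _
  have hcp : c ∉ p := fun h => hxd (p.mem_of_star_mul_self_mem h)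
  have hcd : c = d * (star x * (x * d)) := by rw [hc, star_mul, hd.star_eq, mul_assoc]
  have hcL : c ∈ L := hcd ▸ L.mul_mem_left d (L.mul_mem_left _ (L.mul_mem_right d hx))
  -- The cut-downs `c - δ • g` tend to `c` as `δ → 0`; if all of them were in the closed ideal `p`,
  -- so would be `c`.
  by_contra! hcon
  refine hcp (p.mem_of_forall_norm_sub_le fun δ hδ => ?_)
  obtain ⟨k, g, hgk, hg0, hg1, hgc, -⟩ := exists_cutoff hc0 hδ
  refine ⟨c - δ • g, by_contra fun hnot => ?_, ?_⟩
  · refine hcon (c - δ • g) g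
      ((IsSelfAdjoint.of_nonneg hc0).sub (.of_nonneg (smul_nonneg hδ.le hg0)))
      hnot (hgk ▸ L.mul_mem_right k hcL) hg1 hgc
      ⟨star x * (x * d) - δ • (star x * (x * d) * k), ?_⟩ (star x * (x * d) * k) ?_
    · rw [mul_sub, mul_smul_comm, ← mul_assoc d _ k, ← hcd, ← hgk]
    · rw [← mul_assoc, ← hcd, hgk]
  · rw [sub_sub_cancel, norm_smul, Real.norm_of_nonneg hδ.le]
    have : ‖g‖ ≤ 1 := (CStarAlgebra.norm_le_one_iff_of_nonneg g hg0).2 hg1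
    nlinarith

/-- If the ideals `L n` are dense in `J` relative to `p`, then some state vanishing on `p` is one on
suitable elements of all the ideals `L n` and `J`. -/
theorem exists_units_of_dense (p J : ClosedIdeal D) (L : ℕ → ClosedIdeal D)
    {d₀ : D} (hd₀ : IsSelfAdjoint d₀) (hd₀J : d₀ ∈ J) (hd₀p : d₀ ∉ p)
    (hL : ∀ n, ∀ d ∈ J, d ∉ p → ∃ x ∈ L n, x * d ∉ p) :
    ∃ g : ℕ → D, (∀ n, g n ∈ L n ∧ g n ∈ J ∧ g n ≤ 1) ∧
      {f ∈ annihilatingStates p | ∀ n, f (g n) = 1}.Nonempty := by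
  have hstep : ∀ (n : ℕ) (d : {d : D // IsSelfAdjoint d ∧ d ∈ J ∧ d ∉ p}),
      ∃ (d' : {d : D // IsSelfAdjoint d ∧ d ∈ J ∧ d ∉ p}) (g : D),
        (g ∈ L n ∧ g ∈ J ∧ g ≤ 1) ∧ g * d'.1 = d'.1 ∧ ∃ z, d'.1 = d.1 * z := by
    rintro n ⟨d, hds, hdJ, hdp⟩
    obtain ⟨x, hx, hxd⟩ := hL n d hdJ hdp
    obtain ⟨d', g, h1, h2, h3, h4, h5, ⟨z, hz⟩, w, hw⟩ := exists_local_unit p (L n) hds hx hxd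
    exact ⟨⟨d', h1, hz ▸ J.mul_mem_right z hdJ, h2⟩, g, ⟨h3, hw ▸ J.mul_mem_right w hdJ, h4⟩,
      h5, z, hz⟩
  choose next unit hunit hnext hmul using hstep
  let d : ℕ → {d : D // IsSelfAdjoint d ∧ d ∈ J ∧ d ∉ p} :=
    fun n => Nat.rec ⟨d₀, hd₀, hd₀J, hd₀p⟩ next n
  let g : ℕ → D := fun n => unit n (d n)
  -- `d (n + 1)` has the left unit `g n`, and each later `d m` is a right multiple of it. These
  -- nested elements replace the shrinking open sets of the classical Baire argument.
  have hgd : ∀ n m, n < m → g n * (d m).1 = (d m).1 := by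
    intro n m hnm
    induction m, hnm using Nat.le_induction with
    | base => exact hnext n (d n)
    | succ m _ ih =>
      obtain ⟨z, hz⟩ := hmul m (d m)
      change g n * (next m (d m)).1 = (next m (d m)).1
      rw [hz, ← mul_assoc, ih]
  refine ⟨g, fun n => hunit n (d n), ?_⟩
  let T : ℕ → Set (WeakDual ℂ D) := fun m => {f ∈ annihilatingStates p | ∀ n ≤ m, f (g n) = 1}
  have hTc : ∀ m, IsClosed (T m) := fun m => by
    have : T m = annihilatingStates p ∩ ⋂ n : {n // n ≤ m}, {f : WeakDual ℂ D | f (g n.1) = 1} := by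
      ext f
      simp [T]
    rw [this]
    exact (isClosed_annihilatingStates p).inter (isClosed_iInter fun n =>
      isClosed_eq (WeakDual.eval_continuous _) continuous_const)
  have hTne : ∀ m, (T m).Nonempty := fun m => by
    -- The index is `m + 1` because `g n` fixes `d m` only for `n < m`. Compressing `h` by `e = d (m
    -- + 1)` and normalizing gives a state with value one at `g 0, …, g m`.
    obtain ⟨h, hpos, hvan, hne⟩ := exists_positive_functional p (d (m + 1)).2.2.2
    set e : D := (d (m + 1)).1
    let f : D →L[ℂ] ℂ := (h (star e * e))⁻¹ •
      h.comp ((ContinuousLinearMap.mul ℂ D (star e)).comp ((ContinuousLinearMap.mul ℂ D).flip e))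
    have hfx : ∀ x, f x = (h (star e * e))⁻¹ * h (star e * (x * e)) := fun x => rfl
    have hpos' : 0 ≤ (h (star e * e))⁻¹ := by
      have h0 := hpos _ (star_mul_self_nonneg e)
      have h1 : h (star e * e) = ((h (star e * e)).re : ℂ) :=
        Complex.eq_re_of_ofReal_le h0
      rw [h1, ← Complex.ofReal_inv, Complex.zero_le_real]
      exact inv_nonneg.2 (Complex.le_def.1 h0).1
    refine ⟨StrongDual.toWeakDual f, ⟨?_, fun x hx => ?_, fun q hq => ?_⟩, fun n hn => ?_⟩
    · change f 1 = 1
      rw [hfx, one_mul, inv_mul_cancel₀ hne]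
    · change 0 ≤ f x
      rw [hfx]
      refine mul_nonneg hpos' (hpos _ ?_)
      rw [← mul_assoc]
      exact star_left_conjugate_nonneg hx e
    · change f q = 0
      rw [hfx, hvan _ (p.mul_mem_left _ (p.mul_mem_right _ hq)), mul_zero]
    · change f (g n) = 1
      rw [hfx, hgd n (m + 1) (Nat.lt_succ_of_le hn), inv_mul_cancel₀ hne]
  obtain ⟨f, hf⟩ := IsCompact.nonempty_iInter_of_sequence_nonempty_isCompact_isClosed T
    (fun m f hf => ⟨hf.1, fun n hn => hf.2 n (hn.trans m.le_succ)⟩) hTne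
    ((isCompact_annihilatingStates p).of_isClosed_subset (hTc 0) fun f hf => hf.1) hTc
  exact ⟨f, (Set.mem_iInter.1 hf 0).1, fun n => (Set.mem_iInter.1 hf n).2 n le_rfl⟩

open scoped InnerProductSpace in
/-- A Baire category theorem for irreducible representations of unital C*-algebras. -/
theorem exists_irreducible_of_dense (p J : ClosedIdeal D) (L : ℕ → ClosedIdeal D)
    {d₀ : D} (hd₀ : IsSelfAdjoint d₀) (hd₀J : d₀ ∈ J) (hd₀p : d₀ ∉ p)
    (hL : ∀ n, ∀ d ∈ J, d ∉ p → ∃ x ∈ L n, x * d ∉ p) :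
    ∃ (H : Type u) (_ : NormedAddCommGroup H) (_ : InnerProductSpace ℂ H) (_ : CompleteSpace H)
      (ρ : D →⋆ₐ[ℂ] (H →L[ℂ] H)),
      (∀ K : Submodule ℂ H, IsClosed (K : Set H) → (∀ a, ∀ x ∈ K, ρ a x ∈ K) → K = ⊥ ∨ K = ⊤) ∧
      (∀ q ∈ p, ρ q = 0) ∧ ∀ n, ∃ x ∈ L n, x ∈ J ∧ ρ x ≠ 0 := by
  obtain ⟨g, hg, hne⟩ := exists_units_of_dense p J L hd₀ hd₀J hd₀p hL
  have hclosed : IsClosed {f ∈ annihilatingStates p | ∀ n, f (g n) = 1} := by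
    have : {f ∈ annihilatingStates p | ∀ n, f (g n) = 1} =
        annihilatingStates p ∩ ⋂ n, {f : WeakDual ℂ D | f (g n) = 1} := by
      ext f
      simp
    rw [this]
    exact (isClosed_annihilatingStates p).inter (isClosed_iInter fun n =>
      isClosed_eq (WeakDual.eval_continuous _) continuous_const)
  have hcompact := (isCompact_annihilatingStates p).of_isClosed_subset hclosed fun f hf => hf.1
  have : IsScalarTower ℝ ℂ (WeakDual ℂ D) :=
    ⟨fun r c f => DFunLike.ext _ _ fun x => smul_assoc r c (f x)⟩
  have : LocallyConvexSpace ℝ (WeakDual ℂ D) :=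
    (WeakDual.withSeminorms (𝕜 := ℂ) (E := D)).toLocallyConvexSpace
  -- Krein–Milman, for which the weak-* dual is viewed as a real locally convex space.
  obtain ⟨f, hf⟩ := hcompact.extremePoints_nonempty hne
  obtain ⟨H, _, _, _, ρ, ξ, hρ, hξ⟩ :=
    exists_cyclic_representation (WeakDual.toStrongDual f) hf.1.1.2.1
  have hρ' : ∀ x, ⟪ξ, ρ x ξ⟫_ℂ = f x := hρ
  have hp : ∀ q ∈ p, ρ q = 0 := fun q hq => by
    refine ContinuousLinearMap.ext fun z => ?_
    refine hξ.induction_on z (isClosed_eq (ρ q).continuous continuous_const) fun x => ?_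
    refine inner_self_eq_zero (𝕜 := ℂ).1 ?_
    have e : ρ q (ρ x ξ) = ρ (q * x) ξ := by rw [map_mul, mul_apply_eq_comp]
    rw [e, ← ContinuousLinearMap.adjoint_inner_right, ← ContinuousLinearMap.star_eq_adjoint,
      ← map_star, ← mul_apply_eq_comp, ← map_mul, hρ']
    exact hf.1.1.2.2 _ (p.mul_mem_left _ (p.mul_mem_right x hq))
  refine ⟨H, inferInstance, inferInstance, inferInstance, ρ,
    eq_bot_or_eq_top_of_mem_extremePoints (fun n => (hg n).2.2) hf ρ hρ' hξ hp, hp,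
    fun n => ⟨g n, (hg n).1, (hg n).2.1, fun h => ?_⟩⟩
  have h1 := hf.1.2 n
  rw [← hρ', h, zero_apply, inner_zero_right] at h1
  exact zero_ne_one h1

end LocalUnits

/-! ### Passage to the unitization, and the Baire property of primitive ideals. -/

section NonUnital

variable {A : Type u} [NonUnitalCStarAlgebra A]

namespace ClosedIdeal

/-- A closed ideal of `A`, viewed as a closed ideal of the unitization of `A`. -/
noncomputable def unitize (I : ClosedIdeal A) : ClosedIdeal (Unitization ℂ A) where
  carrier := (Unitization.inr : A → Unitization ℂ A) '' I
  zero_mem' := ⟨0, zero_mem I, Unitization.inr_zero ℂ⟩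
  add_mem' := by
    rintro _ _ ⟨x, hx, rfl⟩ ⟨y, hy, rfl⟩
    exact ⟨x + y, add_mem hx hy, Unitization.inr_add ℂ x y⟩
  smul_mem' := by
    rintro c _ ⟨x, hx, rfl⟩
    exact ⟨c • x, SMulMemClass.smul_mem c hx, Unitization.inr_smul ℂ c x⟩
  isClosed' :=
    (Unitization.isometry_inr (𝕜 := ℂ) (A := A)).isClosedEmbedding.isClosedMap _ I.isClosed
  mul_mem_left' := by
    rintro a _ ⟨x, hx, rfl⟩
    induction a using Unitization.ind with
    | inl_add_inr r a =>
      refine ⟨r • x + a * x, add_mem (SMulMemClass.smul_mem r hx) (I.mul_mem_left a hx), ?_⟩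
      rw [add_mul, Unitization.inl_mul_inr, Unitization.inr_add, Unitization.inr_mul]
  mul_mem_right' := by
    rintro a _ ⟨x, hx, rfl⟩
    induction a using Unitization.ind with
    | inl_add_inr r a =>
      refine ⟨r • x + x * a, add_mem (SMulMemClass.smul_mem r hx) (I.mul_mem_right a hx), ?_⟩
      rw [mul_add, Unitization.inr_mul_inl, Unitization.inr_add, Unitization.inr_mul]

theorem inr_mem_unitize {I : ClosedIdeal A} {a : A} : (a : Unitization ℂ A) ∈ I.unitize ↔ a ∈ I :=
  ⟨fun ⟨_, hb, h⟩ => Unitization.inr_injective h ▸ hb, fun h => ⟨a, h, rfl⟩⟩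

theorem mem_of_star_mul_self_mem' (I : ClosedIdeal A) {x : A} (h : star x * x ∈ I) : x ∈ I := by
  let _ := CStarAlgebra.spectralOrder (Unitization ℂ A)
  have := CStarAlgebra.spectralOrderedRing (Unitization ℂ A)
  rw [← inr_mem_unitize] at h ⊢
  refine I.unitize.mem_of_star_mul_self_mem ?_
  rwa [← Unitization.inr_star, ← Unitization.inr_mul]

theorem star_mem' (I : ClosedIdeal A) {x : A} (h : x ∈ I) : star x ∈ I := by
  refine I.mem_of_star_mul_self_mem' (x := star x) ?_
  rw [star_star]
  exact I.mul_mem_right _ h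

/-- The elements of `J` that `L` multiplies into `p`. -/
def residual (L J p : ClosedIdeal A) : ClosedIdeal A where
  carrier := {x | x ∈ J ∧ ∀ l ∈ L, l * x ∈ p}
  zero_mem' := ⟨zero_mem J, fun l _ => by rw [mul_zero]; exact zero_mem p⟩
  add_mem' := fun hx hy => ⟨add_mem hx.1 hy.1, fun l hl => by
    rw [mul_add]; exact add_mem (hx.2 l hl) (hy.2 l hl)⟩
  smul_mem' := fun c x hx => ⟨SMulMemClass.smul_mem c hx.1, fun l hl => by
    rw [mul_smul_comm]; exact SMulMemClass.smul_mem c (hx.2 l hl)⟩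
  isClosed' := by
    have : {x | x ∈ J ∧ ∀ l ∈ L, l * x ∈ p} =
        (J : Set A) ∩ ⋂ l ∈ L, (fun x => l * x) ⁻¹' (p : Set A) := by
      ext x
      simp
    change IsClosed {x | x ∈ J ∧ ∀ l ∈ L, l * x ∈ p}
    rw [this]
    exact J.isClosed.inter (isClosed_biInter fun l _ =>
      p.isClosed.preimage (continuous_const_mul l))
  mul_mem_left' := fun a _ hx => ⟨J.mul_mem_left a hx.1, fun l hl => by
    rw [← mul_assoc]; exact hx.2 _ (L.mul_mem_right a hl)⟩
  mul_mem_right' := fun a _ hx => ⟨J.mul_mem_right a hx.1, fun l hl => by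
    rw [← mul_assoc]; exact p.mul_mem_right a (hx.2 _ hl)⟩

end ClosedIdeal

/-- A Baire category theorem for the primitive ideal space: if the open sets of primitive ideals
corresponding to `L n` are dense in the intersection of the hull of `p` with the open set
corresponding to `J`, then they have a common point there. -/
theorem exists_primitive_of_dense {p J : ClosedIdeal A} (L : ℕ → ClosedIdeal A) (hJ : ¬ J ≤ p)
    (hL : ∀ n, ∀ K ≤ J, L n ⊓ K ≤ p → K ≤ p) :
    ∃ P : PrimitiveSpace A, p ≤ P.1 ∧ ¬ J ≤ P.1 ∧ ∀ n, ¬ L n ≤ P.1 := by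
  let _ := CStarAlgebra.spectralOrder (Unitization ℂ A)
  have := CStarAlgebra.spectralOrderedRing (Unitization ℂ A)
  obtain ⟨b, hbJ, hbp⟩ : ∃ b ∈ J, b ∉ p := by
    by_contra! h
    exact hJ h
  have hdense : ∀ n, ∀ d ∈ J.unitize, d ∉ p.unitize → ∃ x ∈ (L n).unitize, x * d ∉ p.unitize := by
    rintro n _ ⟨d, hd, rfl⟩ hdp
    rw [ClosedIdeal.inr_mem_unitize] at hdp
    by_contra! hcon
    -- The residual ideal meets `L n` inside `p`: for `x` in both, `star x ∈ L n`, so `star x * x ∈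
    -- p`. Density then forces it into `p`, but it would contain `d`.
    refine hdp (hL n (ClosedIdeal.residual (L n) J p) (fun x hx => hx.1) ?_
      (show d ∈ ClosedIdeal.residual (L n) J p from ⟨hd, fun l hl => ?_⟩))
    · rintro x ⟨hxL, hx⟩
      exact p.mem_of_star_mul_self_mem' (hx.2 _ ((L n).star_mem' hxL))
    · have := hcon l (ClosedIdeal.inr_mem_unitize.2 hl)
      rwa [← Unitization.inr_mul, ClosedIdeal.inr_mem_unitize] at this
  obtain ⟨H, _, _, _, ρ, hirr, hp, hne⟩ := exists_irreducible_of_dense p.unitize J.unitize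
    (fun n => (L n).unitize) (d₀ := ((star b * b : A) : Unitization ℂ A))
    (by rw [Unitization.inr_mul, Unitization.inr_star]; exact .star_mul_self _)
    (ClosedIdeal.inr_mem_unitize.2 (J.mul_mem_left _ hbJ))
    (fun h => hbp (p.mem_of_star_mul_self_mem' (ClosedIdeal.inr_mem_unitize.1 h))) hdense
  let σ : A →⋆ₙₐ[ℂ] (H →L[ℂ] H) :=
    (ρ : Unitization ℂ A →⋆ₙₐ[ℂ] (H →L[ℂ] H)).comp (Unitization.inrNonUnitalStarAlgHom ℂ A)
  have hσ : ∀ a, σ a = ρ a := fun a => rfl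
  have hσc : Continuous σ := AddMonoidHomClass.continuous_of_bound σ 1 fun a => by
    simpa using NonUnitalStarAlgHom.norm_apply_le σ a
  let P : ClosedIdeal A :=
    { carrier := {a | σ a = 0}
      zero_mem' := map_zero σ
      add_mem' := fun {x y} hx hy => by
        change σ (x + y) = 0
        rw [map_add, hx, hy, add_zero]
      smul_mem' := fun c x hx => by
        change σ (c • x) = 0
        rw [map_smul, hx, smul_zero]
      isClosed' := isClosed_eq hσc continuous_const
      mul_mem_left' := fun a x hx => by
        change σ (a * x) = 0
        rw [map_mul, hx, mul_zero]
      mul_mem_right' := fun a x hx => by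
        change σ (x * a) = 0
        rw [map_mul, hx, zero_mul] }
  have hP : ∀ a, a ∈ P ↔ σ a = 0 := fun a => Iff.rfl
  have hLJ : ∀ n, ∃ x ∈ L n, x ∈ J ∧ x ∉ P := fun n => by
    obtain ⟨_, ⟨x, hx, rfl⟩, hxJ, hx0⟩ := hne n
    exact ⟨x, hx, ClosedIdeal.inr_mem_unitize.1 hxJ, hx0⟩
  refine ⟨⟨P, H, inferInstance, inferInstance, inferInstance, σ, ⟨?_, fun K hK hinv => ?_⟩, hP⟩,
    fun q hq => hp _ (ClosedIdeal.inr_mem_unitize.2 hq), fun hle => ?_, fun n hle => ?_⟩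
  · obtain ⟨x, -, -, hx⟩ := hLJ 0
    exact ⟨x, hx⟩
  -- Scalars preserve every subspace, so invariance under `A` is invariance under its unitization.
  · refine hirr K hK fun a x hx => ?_
    induction a using Unitization.ind with
    | inl_add_inr r a =>
      have e : (Unitization.inl r : Unitization ℂ A) = algebraMap ℂ _ r := rfl
      rw [map_add, e, AlgHomClass.commutes, add_apply, Algebra.algebraMap_eq_smul_one]
      exact K.add_mem (K.smul_mem r hx) (hinv a x hx)
  · obtain ⟨x, -, hxJ, hx⟩ := hLJ 0
    exact hx (hle hxJ)
  · obtain ⟨x, hxL, -, hx⟩ := hLJ n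
    exact hx (hle hxL)

/-- A closed ideal is determined by the primitive ideals that contain it. -/
theorem le_of_forall_primitive {I K : ClosedIdeal A}
    (h : ∀ P : PrimitiveSpace A, K ≤ P.1 → I ≤ P.1) : I ≤ K := by
  by_contra hI
  -- For the constant sequence `I` inside the open set of `I` itself, density is trivial.
  obtain ⟨P, hKP, hIP, -⟩ := exists_primitive_of_dense (fun _ : ℕ => I) hI
    fun _ K' hK' hle => (le_inf hK' le_rfl).trans hle
  exact hIP (h P hKP)

end NonUnital

/-! ### Open sets of the primitive ideal space, and functoriality of prime spectra. -/

section Topology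

open scoped Topology

/-- If a family of sets is closed under finite intersections and arbitrary unions, then it contains
all open sets of the topology that it generates. -/
theorem isOpen_generateFrom_range_iff {X ι : Type*} {U : ι → Set X} (huniv : ∃ i, U i = Set.univ)
    (hinter : ∀ i j, ∃ k, U k = U i ∩ U j) (hunion : ∀ S : Set ι, ∃ k, U k = ⋃ i ∈ S, U i)
    {s : Set X} : IsOpen[TopologicalSpace.generateFrom (Set.range U)] s ↔ ∃ i, U i = s := by
  refine ⟨fun h => ?_, fun ⟨i, hi⟩ => .basic _ ⟨i, hi⟩⟩
  induction h with
  | basic s hs => exact hs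
  | univ => exact huniv
  | inter s t _ _ hs ht =>
    obtain ⟨i, rfl⟩ := hs
    obtain ⟨j, rfl⟩ := ht
    exact hinter i j
  | sUnion S _ hS =>
    obtain ⟨k, hk⟩ := hunion {i | U i ∈ S}
    refine ⟨k, hk.trans (Set.Subset.antisymm ?_ ?_)⟩
    · exact Set.iUnion₂_subset fun i hi => Set.subset_sUnion_of_mem hi
    · refine Set.sUnion_subset fun s hs => ?_
      obtain ⟨i, rfl⟩ := hS s hs
      exact Set.subset_biUnion_of_mem (u := U) hs

/-- Primitive ideals are prime, so meets of ideals give intersections of the generating sets, while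
joins give unions. -/
theorem PrimitiveSpace.isOpen_iff {A : Type u} [NonUnitalCStarAlgebra A]
    {s : Set (PrimitiveSpace A)} :
    IsOpen s ↔ ∃ I : ClosedIdeal A, {P : PrimitiveSpace A | ¬ I ≤ P.1} = s := by
  refine isOpen_generateFrom_range_iff
    (U := fun I : ClosedIdeal A => {P : PrimitiveSpace A | ¬ I ≤ P.1}) ⟨⊤, ?_⟩
    (fun I J => ⟨I ⊓ J, ?_⟩) (fun S => ⟨sSup S, ?_⟩)
  · exact Set.eq_univ_of_forall fun P h => P.2.ne_top (top_le_iff.1 h)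
  · ext P
    refine ⟨fun h => ⟨fun h' => h (inf_le_left.trans h'), fun h' => h (inf_le_right.trans h')⟩,
      fun h h' => (P.2.le_or_le h').elim h.1 h.2⟩
  · ext P
    simp

/-- The map between the spaces of prime elements induced by an isomorphism of lattices. -/
def PrimeSpace.map {L M : Type*} [PartialOrder L] [PartialOrder M] (e : L ≃o M)
    (p : PrimeSpace L) : PrimeSpace M :=
  ⟨e p.1, fun h => p.2.1 fun b hb => by
      have := h (e.monotone hb)
      exact e.le_iff_le.1 this,
    fun a b m hm hle => by
      have hm' : IsGLB {e.symm a, e.symm b} (e.symm m) := by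
        have := e.symm.isGLB_image'.2 hm
        rwa [Set.image_pair] at this
      rw [← e.symm_apply_le, ← e.symm_apply_le]
      exact p.2.2 _ _ _ hm' (e.symm_apply_le.2 hle)⟩

theorem PrimeSpace.continuous_map {L M : Type*} [PartialOrder L] [PartialOrder M] (e : L ≃o M) :
    Continuous (PrimeSpace.map e) := by
  refine continuous_generateFrom_iff.2 ?_
  rintro _ ⟨a, rfl⟩
  refine .basic _ ⟨e.symm a, ?_⟩
  ext p
  exact not_congr e.symm_apply_le

/-- Isomorphic lattices have homeomorphic spaces of prime elements. -/
def PrimeSpace.homeomorph {L M : Type*} [PartialOrder L] [PartialOrder M] (e : L ≃o M) :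
    PrimeSpace L ≃ₜ PrimeSpace M where
  toFun := PrimeSpace.map e
  invFun := PrimeSpace.map e.symm
  left_inv p := Subtype.ext (e.symm_apply_apply p.1)
  right_inv p := Subtype.ext (e.apply_symm_apply p.1)
  continuous_toFun := PrimeSpace.continuous_map e
  continuous_invFun := PrimeSpace.continuous_map e.symm

end Topology

/-! ### The Galois connection and prime restricted ideals. -/

section Galois

variable {A : Type u} [NonUnitalCStarAlgebra A] {B : Type v} [NonUnitalCStarAlgebra B]
  (φ : A →⋆ₙₐ[ℂ] DoubleCentralizer ℂ B)

/-- An element of a C*-algebra belongs to a closed ideal if all its left multiples do. -/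
theorem ClosedIdeal.mem_of_forall_mul_mem_left (J : ClosedIdeal B) {x : B}
    (h : ∀ b : B, b * x ∈ J) : x ∈ J :=
  J.mem_of_star_mul_self_mem' (h _)

/-- An element of a C*-algebra belongs to a closed ideal if all its right multiples do. -/
theorem ClosedIdeal.mem_of_forall_mul_mem_right (J : ClosedIdeal B) {x : B}
    (h : ∀ b : B, x * b ∈ J) : x ∈ J := by
  rw [← star_star x]
  refine J.star_mem' (J.mem_of_forall_mul_mem_left fun b => ?_)
  have := J.star_mem' (h (star b))
  rwa [star_mul, star_star] at this

/-- Induction and restriction of ideals form a Galois connection. -/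
theorem galoisConnection_induce_restrict : GaloisConnection (induce φ) (restrict φ) := by
  intro I J
  constructor
  · intro h x hx b
    have hmem : ∀ b₁ b₂ : B, b₁ * (φ x).fst b₂ ∈ J := fun b₁ b₂ =>
      h (subset_closure (Submodule.subset_span ⟨b₁, b₂, x, hx, rfl⟩))
    refine ⟨J.mem_of_forall_mul_mem_left fun c => hmem c b,
      J.mem_of_forall_mul_mem_right fun c => ?_⟩
    rw [(φ x).central]
    exact hmem b c
  · intro h
    have hs : Submodule.span ℂ {y : B | ∃ b₁ b₂ : B, ∃ x ∈ I, y = b₁ * (φ x).fst b₂} ≤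
        J.toSubmodule := by
      refine Submodule.span_le.2 ?_
      rintro _ ⟨b₁, b₂, x, hx, rfl⟩
      exact J.mul_mem_left b₁ (h hx b₂).1
    exact Submodule.topologicalClosure_minimal _ hs J.isClosed

variable {φ}

theorem le_restrict_induce (I : ClosedIdeal A) : I ≤ restrict φ (induce φ I) :=
  (galoisConnection_induce_restrict φ).le_u_l I

theorem IsRestricted.restrict_induce {I : ClosedIdeal A} (hI : IsRestricted φ I) :
    restrict φ (induce φ I) = I := by
  obtain ⟨J, rfl⟩ := hI
  exact (galoisConnection_induce_restrict φ).u_l_u_eq_u J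

/-- Restricted ideals are the closed elements of `r ∘ i`, so passing to the closure of `K` does not
change whether it lies below one. -/
theorem IsRestricted.restrict_induce_le_iff {I K : ClosedIdeal A} (hI : IsRestricted φ I) :
    restrict φ (induce φ K) ≤ I ↔ K ≤ I := by
  refine ⟨(le_restrict_induce K).trans, fun h => ?_⟩
  rw [← hI.restrict_induce]
  exact (galoisConnection_induce_restrict φ).monotone_u
    ((galoisConnection_induce_restrict φ).monotone_l h)

theorem isRestricted_restrict (J : ClosedIdeal B) : IsRestricted φ (restrict φ J) := ⟨J, rfl⟩

variable (φ) in
/-- The lattices of restricted and induced ideals are isomorphic. -/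
def restrictedIdealOrderIso : RestrictedIdeal φ ≃o InducedIdeal φ where
  toFun I := ⟨induce φ I.1, I.1, rfl⟩
  invFun J := ⟨restrict φ J.1, J.1, rfl⟩
  left_inv I := Subtype.ext I.2.restrict_induce
  right_inv := by
    rintro ⟨_, I, rfl⟩
    exact Subtype.ext ((galoisConnection_induce_restrict φ).l_u_l_eq_l I)
  map_rel_iff' {I K} := by
    change induce φ I.1 ≤ induce φ K.1 ↔ I.1 ≤ K.1
    rw [galoisConnection_induce_restrict φ, K.2.restrict_induce]

theorem PrimeRestricted.not_top_le (p : PrimeRestricted φ) : ¬ ⊤ ≤ p.1.1 := fun h =>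
  p.2.1 fun I _ => show I.1 ≤ p.1.1 from le_top.trans h

theorem PrimeRestricted.le_or_le (p : PrimeRestricted φ) {I J : ClosedIdeal A}
    (hI : IsRestricted φ I) (hJ : IsRestricted φ J) (h : I ⊓ J ≤ p.1.1) :
    I ≤ p.1.1 ∨ J ≤ p.1.1 := by
  refine p.2.2 ⟨I, hI⟩ ⟨J, hJ⟩ ⟨I ⊓ J, hI.inf hJ⟩ ⟨?_, fun K hK => ?_⟩ h
  · rintro K (rfl | rfl)
    · exact Subtype.coe_le_coe.1 inf_le_left
    · exact Subtype.coe_le_coe.1 inf_le_right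
  · have h₁ : K.1 ≤ I := hK (Set.mem_insert _ _)
    have h₂ : K.1 ≤ J := hK (Set.mem_insert_of_mem _ rfl)
    exact Subtype.coe_le_coe.1 (le_inf h₁ h₂)

/-- Meets handle intersections by primeness. For unions, `hJR` ensures that the join taken among all
ideals is again restricted. -/
theorem PrimeRestricted.isOpen_iff (hJR : JoinsRestricted φ) {s : Set (PrimeRestricted φ)} :
    IsOpen s ↔ ∃ I : RestrictedIdeal φ, {p : PrimeRestricted φ | ¬ I ≤ p.1} = s := by
  refine isOpen_generateFrom_range_iff
    (U := fun I : RestrictedIdeal φ => {p : PrimeRestricted φ | ¬ I ≤ p.1})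
    ⟨⟨⊤, isRestricted_top φ⟩, ?_⟩ (fun I J => ⟨⟨I.1 ⊓ J.1, I.2.inf J.2⟩, ?_⟩)
    (fun S => ⟨⟨sSup (Subtype.val '' S), hJR _ ?_⟩, ?_⟩)
  · exact Set.eq_univ_of_forall fun p => p.not_top_le
  · ext p
    exact ⟨fun h => ⟨fun h' => h (show I.1 ⊓ J.1 ≤ p.1.1 from inf_le_left.trans h'),
      fun h' => h (show I.1 ⊓ J.1 ≤ p.1.1 from inf_le_right.trans h')⟩,
      fun h h' => (p.le_or_le I.2 J.2 h').elim h.1 h.2⟩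
  · rintro _ ⟨I, -, rfl⟩
    exact I.2
  · ext p
    change ¬ sSup (Subtype.val '' S) ≤ p.1.1 ↔ _
    simp [← Subtype.coe_le_coe]

/-! ### The map `π`: continuity, and what openness implies. -/

variable {hJR : JoinsRestricted φ}

theorem quasiOrbitProj_le (P : PrimitiveSpace A) : (quasiOrbitProj φ hJR P).1.1 ≤ P.1 :=
  (isGreatest_restrictedCore hJR P.1).1.2

theorem le_quasiOrbitProj_iff {I : ClosedIdeal A} (hI : IsRestricted φ I) {P : PrimitiveSpace A} :
    I ≤ (quasiOrbitProj φ hJR P).1.1 ↔ I ≤ P.1 :=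
  ⟨fun h => h.trans (quasiOrbitProj_le P), fun h =>
    (isGreatest_restrictedCore hJR P.1).2 ⟨hI, h⟩⟩

theorem restrict_induce_le_quasiOrbitProj_iff {I : ClosedIdeal A} {P : PrimitiveSpace A} :
    restrict φ (induce φ I) ≤ (quasiOrbitProj φ hJR P).1.1 ↔
      I ≤ (quasiOrbitProj φ hJR P).1.1 :=
  (quasiOrbitProj φ hJR P).1.2.restrict_induce_le_iff

theorem continuous_quasiOrbitProj : Continuous (quasiOrbitProj φ hJR) := by
  refine continuous_generateFrom_iff.2 ?_
  rintro _ ⟨I, rfl⟩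
  refine .basic _ ⟨I.1, ?_⟩
  ext P
  exact not_congr (le_quasiOrbitProj_iff I.2).symm

/-- If `π` is open, then a primitive ideal that does not contain `r(i(J))` has the same quasi-orbit
as one that does not contain `J`. -/
theorem exists_quasiOrbitProj_eq_of_isOpenMap (ho : IsOpenMap (quasiOrbitProj φ hJR))
    {J : ClosedIdeal A} {P : PrimitiveSpace A} (hP : ¬ restrict φ (induce φ J) ≤ P.1) :
    ∃ Q : PrimitiveSpace A, ¬ J ≤ Q.1 ∧ quasiOrbitProj φ hJR Q = quasiOrbitProj φ hJR P := by
  -- The image of the open set of `J` is the open set of a restricted ideal `K`. It suffices that `J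
  -- ≤ K`, for then `r(i(J)) ≤ K` and `π P` lies in the image.
  obtain ⟨K, hK⟩ := (PrimeRestricted.isOpen_iff hJR).1
    (ho _ (PrimitiveSpace.isOpen_iff.2 ⟨J, rfl⟩))
  have hJK : J ≤ K.1 := le_of_forall_primitive fun Q hQ => by
    by_contra hJQ
    have : quasiOrbitProj φ hJR Q ∈ {p : PrimeRestricted φ | ¬ K ≤ p.1} :=
      hK ▸ Set.mem_image_of_mem _ hJQ
    exact this ((le_quasiOrbitProj_iff K.2).2 hQ)
  have hPK : quasiOrbitProj φ hJR P ∈ {p : PrimeRestricted φ | ¬ K ≤ p.1} := fun h =>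
    hP ((K.2.restrict_induce_le_iff.2 hJK).trans ((le_quasiOrbitProj_iff K.2).1 h))
  rwa [hK] at hPK

/-- Suppose `P` contains the right side but not the left. Some `Q` in the quasi-orbit of `P` then
fails to contain `J`; it also fails to contain the restricted ideal `I`, which only sees
quasi-orbits. Yet `I ⊓ J ≤ π P = π Q ≤ Q`, against primeness of `Q`. -/
theorem inf_restrict_induce_of_isOpenMap (ho : IsOpenMap (quasiOrbitProj φ hJR))
    {I J : ClosedIdeal A} (hI : IsRestricted φ I) :
    I ⊓ restrict φ (induce φ J) = restrict φ (induce φ (I ⊓ J)) := by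
  refine le_antisymm (le_of_forall_primitive fun P hP => ?_) ?_
  · by_contra hcon
    obtain ⟨Q, hJQ, hQP⟩ := exists_quasiOrbitProj_eq_of_isOpenMap ho
      fun h => hcon (inf_le_right.trans h)
    have hIQ : ¬ I ≤ Q.1 := fun h => hcon (inf_le_left.trans
      ((le_quasiOrbitProj_iff hI).1 (hQP ▸ (le_quasiOrbitProj_iff hI).2 h)))
    have hIJ : I ⊓ J ≤ Q.1 := by
      have h := (le_quasiOrbitProj_iff (hJR := hJR) (isRestricted_restrict _)).2 hP
      rw [← hQP] at h
      exact (le_restrict_induce _).trans (h.trans (quasiOrbitProj_le Q))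
    exact (Q.2.le_or_le hIJ).elim hIQ hJQ
  · refine le_inf (hI.restrict_induce_le_iff.2 inf_le_left) ?_
    exact (isRestricted_restrict _).restrict_induce_le_iff.2
      (inf_le_right.trans (le_restrict_induce J))

/-! ### Countability assumptions, and primitive ideals over a given prime restricted ideal. -/

/-- A countable family of restricted ideals, none contained in `p`, such that a primitive ideal
over `p` that contains none of them contains no restricted ideals except those below `p`. -/
def HasCountableSeparation (p : PrimeRestricted φ) : Prop :=
  ∃ S : Set (ClosedIdeal A), S.Countable ∧ (∀ L ∈ S, IsRestricted φ L ∧ ¬ L ≤ p.1.1) ∧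
    ∀ P : PrimitiveSpace A, (∀ L ∈ S, ¬ L ≤ P.1) →
      ∀ I, IsRestricted φ I → ¬ I ≤ p.1.1 → ¬ I ≤ P.1

/-- Choose one basic open neighbourhood of `p` inside each member of a countable neighbourhood base.
If `P` contains none of the corresponding ideals, then `π P` lies in every neighbourhood of `p`. -/
theorem hasCountableSeparation_of_firstCountable (hJR : JoinsRestricted φ)
    [FirstCountableTopology (PrimeRestricted φ)]
    (p : PrimeRestricted φ) : HasCountableSeparation p := by
  obtain ⟨V, hV⟩ := (nhds p).exists_antitone_basis
  have hL : ∀ n, ∃ L : RestrictedIdeal φ, ¬ L ≤ p.1 ∧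
      {q : PrimeRestricted φ | ¬ L ≤ q.1} ⊆ V n := fun n => by
    obtain ⟨t, htV, hto, hpt⟩ := mem_nhds_iff.1 (hV.mem n)
    obtain ⟨L, rfl⟩ := (PrimeRestricted.isOpen_iff hJR).1 hto
    exact ⟨L, hpt, htV⟩
  choose L hLp hLV using hL
  refine ⟨Set.range fun n => (L n).1, Set.countable_range _, ?_, fun P hP I hI hIp => ?_⟩
  · rintro _ ⟨n, rfl⟩
    exact ⟨(L n).2, hLp n⟩
  · have hmem : {q : PrimeRestricted φ | ¬ (⟨I, hI⟩ : RestrictedIdeal φ) ≤ q.1} ∈ nhds p :=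
      ((PrimeRestricted.isOpen_iff hJR).2 ⟨_, rfl⟩).mem_nhds hIp
    obtain ⟨n, hn⟩ := hV.mem_iff.1 hmem
    have h : ¬ I ≤ (quasiOrbitProj φ hJR P).1.1 := hn (hLV n
      (show ¬ (L n).1 ≤ (quasiOrbitProj φ hJR P).1.1 from fun h =>
        hP _ ⟨n, rfl⟩ ((le_quasiOrbitProj_iff (L n).2).1 h)))
    exact fun h' => h ((le_quasiOrbitProj_iff hI).2 h')

/-- The family consists of the closures `r(i(K))`, not below `p`, of the ideals `K` of a countable
base. If `I` is restricted and not below `p`, some primitive `Q ⊇ p` lies in its open set; a basic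
set around `Q` inside it gives such a `K ≤ I`, and then `r(i(K)) ≤ I`. -/
theorem hasCountableSeparation_of_secondCountable [SecondCountableTopology (PrimitiveSpace A)]
    (p : PrimeRestricted φ) : HasCountableSeparation p := by
  have hb := TopologicalSpace.isBasis_countableBasis (PrimitiveSpace A)
  have hK : ∀ s : TopologicalSpace.countableBasis (PrimitiveSpace A),
      ∃ K : ClosedIdeal A, {P : PrimitiveSpace A | ¬ K ≤ P.1} = s := fun s =>
    PrimitiveSpace.isOpen_iff.1 (hb.isOpen s.2)
  choose K hK using hK
  have hcount : (Set.range fun s => restrict φ (induce φ (K s))).Countable :=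
    have := (TopologicalSpace.countable_countableBasis (PrimitiveSpace A)).to_subtype
    Set.countable_range _
  refine ⟨(Set.range fun s => restrict φ (induce φ (K s))) ∩ {L | ¬ L ≤ p.1.1},
    hcount.mono Set.inter_subset_left, ?_, fun P hP I hI hIp hIP => ?_⟩
  · rintro _ ⟨⟨s, rfl⟩, hs⟩
    exact ⟨isRestricted_restrict _, hs⟩
  · obtain ⟨Q, hpQ, hIQ⟩ : ∃ Q : PrimitiveSpace A, p.1.1 ≤ Q.1 ∧ ¬ I ≤ Q.1 := by
      by_contra! h
      exact hIp (le_of_forall_primitive h)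
    obtain ⟨s, hs, hQs, hsI⟩ := hb.exists_subset_of_mem_open hIQ
      (PrimitiveSpace.isOpen_iff.2 ⟨I, rfl⟩)
    have hKs := hK ⟨s, hs⟩
    have hKI : K ⟨s, hs⟩ ≤ I := le_of_forall_primitive fun Q' hQ' => by
      by_contra hKQ'
      have : Q' ∈ s := by
        have : Q' ∈ {P : PrimitiveSpace A | ¬ K ⟨s, hs⟩ ≤ P.1} := hKQ'
        rwa [hKs] at this
      exact hsI this hQ'
    have hKQ : ¬ K ⟨s, hs⟩ ≤ Q.1 := by
      have : Q ∈ {P : PrimitiveSpace A | ¬ K ⟨s, hs⟩ ≤ P.1} := by rwa [hKs]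
      exact this
    refine hP _ ⟨⟨⟨s, hs⟩, rfl⟩, fun h => ?_⟩ ((hI.restrict_induce_le_iff.2 hKI).trans hIP)
    exact hKQ (((le_restrict_induce _).trans h).trans hpQ)

/-- Prime restricted ideals are hit by `π`, on any open set of primitive ideals that is not
excluded for trivial reasons. -/
theorem exists_quasiOrbitProj_eq
    (hC : ∀ I J : ClosedIdeal A, IsRestricted φ I →
      I ⊓ restrict φ (induce φ J) = restrict φ (induce φ (I ⊓ J)))
    {p : PrimeRestricted φ} (hp : HasCountableSeparation p) {J : ClosedIdeal A}
    (hJ : ¬ J ≤ p.1.1) :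
    ∃ P : PrimitiveSpace A, ¬ J ≤ P.1 ∧ quasiOrbitProj φ hJR P = p := by
  obtain ⟨S, hS, hSp, hsep⟩ := hp
  -- Adjoining `⊤` makes the family nonempty, so that it is the range of a sequence.
  obtain ⟨L, hL⟩ := (hS.insert ⊤).exists_eq_range (Set.insert_nonempty _ _)
  have hLp : ∀ n, IsRestricted φ (L n) ∧ ¬ L n ≤ p.1.1 := fun n => by
    have : L n ∈ insert ⊤ S := hL ▸ Set.mem_range_self n
    rcases this with h | h
    · rw [h]
      exact ⟨isRestricted_top φ, p.not_top_le⟩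
    · exact hSp _ h
  -- Density: `L n ⊓ K ≤ p` gives `r(i(L n ⊓ K)) ≤ p`, which by (C1) reads `L n ⊓ r(i(K)) ≤ p`, and
  -- primeness of `p` leaves `r(i(K)) ≤ p`.
  obtain ⟨P, hpP, hJP, hLP⟩ := exists_primitive_of_dense L hJ fun n K _ hle => by
    have h := p.1.2.restrict_induce_le_iff.2 hle
    rw [← hC _ _ (hLp n).1] at h
    exact p.1.2.restrict_induce_le_iff.1
      ((p.le_or_le (hLp n).1 (isRestricted_restrict _) h).resolve_left (hLp n).2)
  refine ⟨P, hJP, Subtype.ext (Subtype.ext (le_antisymm ?_ ((le_quasiOrbitProj_iff p.1.2).2 hpP)))⟩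
  by_contra hcon
  -- If `π P` were not below `p`, separation would say that it is not below `P`.
  refine hsep P (fun I hI => ?_) _ (quasiOrbitProj φ hJR P).1.2 hcon (quasiOrbitProj_le P)
  obtain ⟨n, rfl⟩ : I ∈ Set.range L := hL ▸ Set.mem_insert_of_mem _ hI
  exact hLP n

end Galois

end QuasiOrbit

theorem theorem4p3 {A : Type*} [NonUnitalCStarAlgebra A] {B : Type*} [NonUnitalCStarAlgebra B]
    (φ : A →⋆ₙₐ[ℂ] DoubleCentralizer ℂ B) (hJR : QuasiOrbit.JoinsRestricted φ) :
    -- the map `π` is continuous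
    Continuous (QuasiOrbit.quasiOrbitProj φ hJR) ∧
    -- if `π` is open and surjective, then `r ∘ i` satisfies the identity below
    (IsOpenMap (QuasiOrbit.quasiOrbitProj φ hJR) ∧
        Function.Surjective (QuasiOrbit.quasiOrbitProj φ hJR) →
      ∀ I J : QuasiOrbit.ClosedIdeal A, QuasiOrbit.IsRestricted φ I →
        I ⊓ QuasiOrbit.restrict φ (QuasiOrbit.induce φ J) =
          QuasiOrbit.restrict φ (QuasiOrbit.induce φ (I ⊓ J))) ∧
    -- the converse under a countability assumption; the homeomorphism maps the class of `P`
    -- to the ideal induced by `π P`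
    ((∀ I J : QuasiOrbit.ClosedIdeal A, QuasiOrbit.IsRestricted φ I →
        I ⊓ QuasiOrbit.restrict φ (QuasiOrbit.induce φ J) =
          QuasiOrbit.restrict φ (QuasiOrbit.induce φ (I ⊓ J))) →
      FirstCountableTopology (QuasiOrbit.PrimeRestricted φ) ∨
        SecondCountableTopology (QuasiOrbit.PrimitiveSpace A) →
      IsOpenMap (QuasiOrbit.quasiOrbitProj φ hJR) ∧
      Function.Surjective (QuasiOrbit.quasiOrbitProj φ hJR) ∧
      ∃ h : QuasiOrbit.QuasiOrbitSpace φ hJR ≃ₜ QuasiOrbit.PrimeInduced φ,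
        ∀ P : QuasiOrbit.PrimitiveSpace A,
          (h (Quotient.mk _ P)).1.1 =
            QuasiOrbit.induce φ (QuasiOrbit.quasiOrbitProj φ hJR P).1.1) := by
  refine ⟨QuasiOrbit.continuous_quasiOrbitProj,
    fun h I J hI => QuasiOrbit.inf_restrict_induce_of_isOpenMap h.1 hI, fun hC hcount => ?_⟩
  have hsep : ∀ p : QuasiOrbit.PrimeRestricted φ, QuasiOrbit.HasCountableSeparation p := fun p => by
    rcases hcount with h | h
    · exact QuasiOrbit.hasCountableSeparation_of_firstCountable hJR p
    · exact QuasiOrbit.hasCountableSeparation_of_secondCountable p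
  have hopen : IsOpenMap (QuasiOrbit.quasiOrbitProj φ hJR) := by
    intro s hs
    obtain ⟨J, rfl⟩ := QuasiOrbit.PrimitiveSpace.isOpen_iff.1 hs
    -- The image of the open set of `J` is the open set of `r(i(J))`.
    refine (QuasiOrbit.PrimeRestricted.isOpen_iff hJR).2
      ⟨⟨_, QuasiOrbit.isRestricted_restrict (QuasiOrbit.induce φ J)⟩, ?_⟩
    ext p
    constructor
    · intro hp
      exact QuasiOrbit.exists_quasiOrbitProj_eq hC (hsep p)
        fun h => hp (p.1.2.restrict_induce_le_iff.2 h)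
    · rintro ⟨P, hP, rfl⟩ h
      exact hP ((QuasiOrbit.restrict_induce_le_quasiOrbitProj_iff.1 h).trans
        (QuasiOrbit.quasiOrbitProj_le P))
  have hsurj : Function.Surjective (QuasiOrbit.quasiOrbitProj φ hJR) := fun p => by
    obtain ⟨P, -, hP⟩ := QuasiOrbit.exists_quasiOrbitProj_eq (hJR := hJR) hC (hsep p) p.not_top_le
    exact ⟨P, hP⟩
  let π : C(QuasiOrbit.PrimitiveSpace A, QuasiOrbit.PrimeRestricted φ) :=
    ⟨QuasiOrbit.quasiOrbitProj φ hJR, QuasiOrbit.continuous_quasiOrbitProj⟩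
  have hq : Topology.IsQuotientMap π := hopen.isQuotientMap π.continuous hsurj
  refine ⟨hopen, hsurj, hq.homeomorph.trans
    (QuasiOrbit.PrimeSpace.homeomorph (QuasiOrbit.restrictedIdealOrderIso φ)), ?_⟩
  exact fun P => rfl
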